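/- For a finite set $V\subseteq\mathbb{R}^d$ and $\alpha\in\mathbb{R}$, a subset $U\subseteq V$ is an $\alpha$-spectral spanner of $V$ if for every $v\in V$ there is a probability distribution $\mu_v$ on $U$ such that $vv^{T}\preceq\alpha\cdot\mathbb{E}_{u\sim\mu_v}uu^{T}$. The greedy algorithm with parameter $\alpha$ on input $V$ starts with $U=\emptyset$. While there is $v\in V$ for which $P_v=\{x\in\mathbb{R}^d:\ \langle x,v\rangle>\sqrt{\alpha}\,|\langle x,u\rangle|\ \text{for all }u\in U\}$ is nonempty, it chooses any such $v$ and any $x\in P_v$, and adds to $U$ some vector of $V$ that maximizes $\langle w,x\rangle^2$ over $w\in V$. When there is no such $v$, it outputs $U$. **Theorem.** (i) There is a universal constant $C>0$ such that the following holds for all $d\ge 2$ and all finite $V\subseteq\mathbb{R}^d$. The greedy algorithm with $\alpha=C\,d\log^2 d$ stops, whatever its choices, after at most $C\,d\log d$ iterations, and its output is a $C\,d\log^2d$-spectral spanner of $V$ with at most $C\,d\log d$ vectors. Moreover, with the same $C$, there is an algorithm (one program of a real RAM with exact operations $+,-,\times,/$ and comparisons of real numbers at unit cost) that, given $d\ge2$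 and any finite $V\subseteq\mathbb{R}^d$, finds a $C\,d\log^2d$-spectral spanner of $V$ with at most $C\,d\log d$ vectors in time polynomial in $d$ and $|V|$. (ii) Conversely, there is a universal constant $c>0$ such that for all $d\ge2$ and all $\epsilon>0$ there is a finite set $V\subseteq\mathbb{R}^d$ with $|V|\ge e^{c\,d^{\epsilon}}$ such that every $d^{1-\epsilon}$-spectral spanner of $V$ contains all vectors of $V$; if $\epsilon\le1$, then $V$ can be chosen in $\{-1,1\}^d$. In fact, if $d\ge 2$, $0<\epsilon\le1$ and $N\le\frac12e^{d^\epsilon/8}$, then $N$ independent uniformly random vectors of $\{-1,1\}^d$ are, with probability at least $\frac12$, distinct and form a set $V$ such that every $d^{1-\epsilon}$-spectral spanner of $V$ contains all vectors of $V$. -/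

import Mathlib

open Matrix

/-- `U` is an `α`-spectral spanner of the finite set `V ⊆ ℝ^d`: `U ⊆ V`, and for every `v ∈ V` there
is a probability distribution `μ` on `U` with `v vᵀ ≼ α · E_{u ∼ μ} u uᵀ` in the Loewner order. -/
def IsSpectralSpanner {d : ℕ} (α : ℝ) (V U : Finset (Fin d → ℝ)) : Prop :=
  U ⊆ V ∧ ∀ v ∈ V, ∃ μ : (Fin d → ℝ) → ℝ,
    (∀ u ∈ U, 0 ≤ μ u) ∧ ∑ u ∈ U, μ u = 1 ∧
    (α • ∑ u ∈ U, μ u • vecMulVec u u - vecMulVec v v).PosSemidef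

/-! ### The greedy algorithm -/

/-- The polytope of the directions in which `v` is not `α`-covered by `U`. -/
def badDirections {d : ℕ} (α : ℝ) (U : Finset (Fin d → ℝ)) (v : Fin d → ℝ) : Set (Fin d → ℝ) :=
  {x | ∀ u ∈ U, √α * |x ⬝ᵥ u| < x ⬝ᵥ v}

/-- `GreedyRun α V k U`: after `k` iterations of its loop, the greedy algorithm may hold the set `U`.
It starts with `∅`; while some `v ∈ V` has a bad direction, it picks any such `v`, any bad direction
`x` of `v`, and adds to `U` a vector `w ∈ V` that maximizes `⟨w, x⟩²` over `V`. -/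
inductive GreedyRun {d : ℕ} (α : ℝ) (V : Finset (Fin d → ℝ)) : ℕ → Finset (Fin d → ℝ) → Prop
  | start : GreedyRun α V 0 ∅
  | iterate {k : ℕ} {U : Finset (Fin d → ℝ)} {v x w : Fin d → ℝ}
      (hrun : GreedyRun α V k U) (hv : v ∈ V) (hx : x ∈ badDirections α U v)
      (hw : w ∈ V) (hmax : ∀ u ∈ V, (u ⬝ᵥ x) ^ 2 ≤ (w ⬝ᵥ x) ^ 2) :
      GreedyRun α V (k + 1) (insert w U)

/-- The stopping condition of the greedy algorithm. -/
def GreedyStops {d : ℕ} (α : ℝ) (V U : Finset (Fin d → ℝ)) : Prop :=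
  ∀ v ∈ V, badDirections α U v = ∅

/-! ### A real random access machine

A program is a fixed finite text, with finitely many arrays of natural numbers (one index) and of
real numbers (two indices), conditionals and loops. Exact real arithmetic `+ - * /` and comparisons
have unit cost; natural numbers, which serve as addresses and counters, have only `+`, `-` and
comparisons. The only constants are natural numbers. -/

namespace RealRAM

/-- The memory: contents of the arrays of naturals and of the arrays of reals. The first argument
is the name of the array. -/
structure Store where
  nat : ℕ → ℕ → ℕ
  real : ℕ → ℕ → ℕ → ℝ

/-- Expressions of type natural number. -/
inductive NExpr
  | lit (n : ℕ)
  | get (a : ℕ) (i : NExpr)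
  | add (x y : NExpr)
  | sub (x y : NExpr)

/-- Expressions of type real number. -/
inductive RExpr
  | ofNat (x : NExpr)
  | get (a : ℕ) (i j : NExpr)
  | add (x y : RExpr)
  | sub (x y : RExpr)
  | mul (x y : RExpr)
  | div (x y : RExpr)

/-- Tests. -/
inductive Test
  | natLE (x y : NExpr)
  | realLE (x y : RExpr)
  | not (b : Test)
  | and (b c : Test)

/-- Programs. -/
inductive Prog
  | skip
  | setNat (a : ℕ) (i x : NExpr)
  | setReal (a : ℕ) (i j : NExpr) (x : RExpr)
  | seq (p q : Prog)
  | ite (b : Test) (p q : Prog)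
  | loop (b : Test) (p : Prog)

/-- Value of an expression; subtraction is truncated. -/
def NExpr.eval (s : Store) : NExpr → ℕ
  | lit n => n
  | get a i => s.nat a (i.eval s)
  | add x y => x.eval s + y.eval s
  | sub x y => x.eval s - y.eval s

/-- Value of an expression; division by zero gives zero. -/
noncomputable def RExpr.eval (s : Store) : RExpr → ℝ
  | ofNat x => (x.eval s : ℝ)
  | get a i j => s.real a (i.eval s) (j.eval s)
  | add x y => x.eval s + y.eval s
  | sub x y => x.eval s - y.eval s
  | mul x y => x.eval s * y.eval s
  | div x y => x.eval s / y.eval s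

/-- Truth of a test. -/
def Test.Holds (s : Store) : Test → Prop
  | natLE x y => x.eval s ≤ y.eval s
  | realLE x y => x.eval s ≤ y.eval s
  | not b => ¬ b.Holds s
  | and b c => b.Holds s ∧ c.Holds s

/-- Write `x` at position `i` of the array `a` of naturals. -/
def Store.writeNat (s : Store) (a i x : ℕ) : Store where
  nat := Function.update s.nat a (Function.update (s.nat a) i x)
  real := s.real

/-- Write `x` at position `(i, j)` of the array `a` of reals. -/
noncomputable def Store.writeReal (s : Store) (a i j : ℕ) (x : ℝ) : Store where
  nat := s.nat
  real := Function.update s.real a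
    (Function.update (s.real a) i (Function.update (s.real a i) j x))

/-- `Exec p s s' t`: started in `s`, the program `p` halts in `s'` after `t` steps. Every assignment
and every test that is executed counts as one step; the expressions in it have a size that is
fixed by the program text. -/
inductive Exec : Prog → Store → Store → ℕ → Prop
  | skip (s : Store) : Exec .skip s s 1
  | setNat (s : Store) (a : ℕ) (i x : NExpr) :
      Exec (.setNat a i x) s (s.writeNat a (i.eval s) (x.eval s)) 1
  | setReal (s : Store) (a : ℕ) (i j : NExpr) (x : RExpr) :
      Exec (.setReal a i j x) s (s.writeReal a (i.eval s) (j.eval s) (x.eval s)) 1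
  | seq {p q : Prog} {s s₁ s₂ : Store} {t₁ t₂ : ℕ} :
      Exec p s s₁ t₁ → Exec q s₁ s₂ t₂ → Exec (.seq p q) s s₂ (t₁ + t₂)
  | iteTrue {b : Test} {p q : Prog} {s s₁ : Store} {t : ℕ} :
      b.Holds s → Exec p s s₁ t → Exec (.ite b p q) s s₁ (t + 1)
  | iteFalse {b : Test} {p q : Prog} {s s₁ : Store} {t : ℕ} :
      ¬ b.Holds s → Exec q s s₁ t → Exec (.ite b p q) s s₁ (t + 1)
  | loopFalse {b : Test} {p : Prog} {s : Store} :
      ¬ b.Holds s → Exec (.loop b p) s s 1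
  | loopTrue {b : Test} {p : Prog} {s s₁ s₂ : Store} {t₁ t₂ : ℕ} :
      b.Holds s → Exec p s s₁ t₁ → Exec (.loop b p) s₁ s₂ t₂ →
      Exec (.loop b p) s s₂ (t₁ + t₂ + 1)

/-- The input `v₀, …, vₙ₋₁ ∈ ℝ^d`: array `0` of naturals holds `d` and `n` at positions `0` and `1`,
array `0` of reals holds coordinate `j` of `vᵢ` at position `(i, j)`; all other cells are `0`. -/
noncomputable def inputStore {d n : ℕ} (v : Fin n → Fin d → ℝ) : Store where
  nat a i := if a = 0 then (if i = 0 then d else if i = 1 then n else 0) else 0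
  real a i j :=
    if a = 0 then (if h : i < n ∧ j < d then v ⟨i, h.1⟩ ⟨j, h.2⟩ else 0) else 0

/-- The output: the set of the input vectors `vᵢ` that are marked by a nonzero entry at position `i`
of array `1` of naturals. -/
def outputSet {d n : ℕ} (v : Fin n ↪ (Fin d → ℝ)) (s : Store) : Finset (Fin d → ℝ) :=
  (Finset.univ.filter fun i : Fin n => s.nat 1 i ≠ 0).map v

end RealRAM

/-- The `±1` vector with a given sign pattern. -/
def signVector {d : ℕ} (b : Fin d → Bool) : Fin d → ℝ := fun j => if b j then 1 else -1

/-! The upper bounds rest on a determinant potential. Adding `u uᵀ` to a positive definite `S` at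
least doubles the determinant as soon as `u` reaches the boundary of the ellipsoid of `S` in some
direction `x`, that is, `xᵀ S x ≤ ⟨u, x⟩²` with `⟨u, x⟩ ≠ 0`. Let `h` vectors, each bounded by `K`
times a form `T`, be added one by one to `δ T`, each sticking out of the form accumulated so far.
After whitening `T` to the identity, AM-GM bounds the last determinant by its trace, so `2 ^ h ≤ (1
+ h K / (δ d)) ^ d` (`two_pow_card_le`). When `K / δ` is of order `h`, this forces `h = O(d log d)`
(`le_of_two_pow_le`).

Greedy algorithm. If `v` has no bad direction, Hahn-Banach puts it into `√α` times the convex hull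
of `±U`, and Cauchy-Schwarz turns that combination into a distribution for the spanner. For the
number of iterations, `T` is the Gram form of `h` chosen vectors themselves: maximality of each
choice bounds `T` in its direction, and the factor `α ≥ 2 h` makes the earlier vectors negligible
there.

Polynomial-time algorithm. Finding bad directions is avoided. A subfamily `W` whose doubled Gram
form dominates every input vector is refined by a pass that keeps the vectors sticking out of
`(2|W|)⁻¹` times the Gram form of `W` plus that of the vectors kept so far. Averaging over `W` shows
that domination survives (`Refines.covers`), and the same potential shows that the size either drops
or is already `O(d log d)` (`Refines.card_le_or_lt`), so `n` passes suffice. Whether a vector sticks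
out is a semidefiniteness question for a bordered matrix, settled by symmetric elimination
(`elim_bordered_last_nonneg_iff`).

Lower bound. If `⟨v, v⟩ = d` and all other squared inner products with `v` are below `d^(1+ε)`,
testing the spanner inequality at `x = v` shows that `v` is indispensable for `α = d^(1-ε)`. Random
sign vectors have this property by a Chernoff estimate and a union bound. -/

/-! ### The determinant potential -/

theorem dotProduct_vecMulVec_mulVec {ι : Type*} [Fintype ι] (u x : ι → ℝ) :
    x ⬝ᵥ (vecMulVec u u *ᵥ x) = (u ⬝ᵥ x) ^ 2 := by
  rw [vecMulVec_mulVec]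
  simp [dotProduct_comm x u, sq]

theorem posSemidef_vecMulVec_self {ι : Type*} [Fintype ι] (u : ι → ℝ) :
    (vecMulVec u u).PosSemidef := by
  simpa using posSemidef_vecMulVec_self_star u

/-- AM-GM for the eigenvalues of a positive semidefinite matrix. -/
theorem Matrix.PosSemidef.det_le_trace_div_pow {d : ℕ} (hd : 0 < d)
    {A : Matrix (Fin d) (Fin d) ℝ} (hA : A.PosSemidef) : A.det ≤ (A.trace / d) ^ d := by
  have hdet := hA.1.det_eq_prod_eigenvalues
  have htr := hA.1.trace_eq_sum_eigenvalues
  have hd' : (0 : ℝ) < d := by exact_mod_cast hd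
  have h := Real.geom_mean_le_arith_mean Finset.univ (fun _ : Fin d => (1 : ℝ)) hA.1.eigenvalues
    (by simp) (by simpa using hd) (fun i _ => hA.eigenvalues_nonneg i)
  simp only [Real.rpow_one, one_mul, Finset.sum_const, Finset.card_univ, Fintype.card_fin,
    nsmul_eq_mul, mul_one] at h
  have h0 : 0 ≤ ∏ i, hA.1.eigenvalues i := Finset.prod_nonneg fun i _ => hA.eigenvalues_nonneg i
  have h2 := pow_le_pow_left₀ (Real.rpow_nonneg h0 _) h d
  rw [← Real.rpow_natCast, ← Real.rpow_mul h0, inv_mul_cancel₀ hd'.ne', Real.rpow_one] at h2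
  simpa [hdet, htr] using h2

/-- By the matrix determinant lemma the determinant grows by the factor `1 + uᵀ S⁻¹ u`.
Cauchy-Schwarz for the form `S` gives `⟨u, x⟩² ≤ (uᵀ S⁻¹ u)(xᵀ S x)`, whence `uᵀ S⁻¹ u ≥ 1`. -/
theorem Matrix.PosDef.two_mul_det_le_det_add_vecMulVec {d : ℕ} {S : Matrix (Fin d) (Fin d) ℝ}
    (hS : S.PosDef) {u x : Fin d → ℝ} (hux : u ⬝ᵥ x ≠ 0) (h : x ⬝ᵥ (S *ᵥ x) ≤ (u ⬝ᵥ x) ^ 2) :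
    2 * S.det ≤ (S + vecMulVec u u).det := by
  have hdet : IsUnit S.det := hS.det_pos.ne'.isUnit
  rw [vecMulVec_eq Unit, det_add_replicateCol_mul_replicateRow hdet]
  have hfac : (1 + replicateRow Unit u * S⁻¹ * replicateCol Unit u).det
      = 1 + u ⬝ᵥ (S⁻¹ *ᵥ u) := by
    rw [det_unique]
    simp [Matrix.mul_apply, dotProduct, mulVec, Finset.sum_mul, Finset.mul_sum]
    rw [Finset.sum_comm]
    simp only [mul_assoc]
  rw [hfac]
  have hSy : S *ᵥ (S⁻¹ *ᵥ u) = u := by simp [mulVec_mulVec, mul_nonsing_inv _ hdet]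
  have hsym : Sᵀ = S := by simpa using hS.1.eq
  set y := S⁻¹ *ᵥ u with hy
  have hxy : y ⬝ᵥ (S *ᵥ x) = u ⬝ᵥ x := by
    rw [dotProduct_mulVec, ← mulVec_transpose, hsym, hSy]
  -- The scaling makes `t x` pair to 1 with `u`; nonnegativity of `S` at `y - t x` then reads `0 ≤
  -- uᵀ S⁻¹ u - 2 + t² xᵀ S x`, with last term at most 1.
  set t := (u ⬝ᵥ x)⁻¹ with ht
  have hnn := hS.posSemidef.dotProduct_mulVec_nonneg (y - t • x)
  simp only [star_trivial, mulVec_sub, mulVec_smul, sub_dotProduct, dotProduct_sub,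
    smul_dotProduct, dotProduct_smul, smul_eq_mul, hSy, hxy, dotProduct_comm x u,
    dotProduct_comm y u] at hnn
  have h1 : t * (u ⬝ᵥ x) = 1 := inv_mul_cancel₀ hux
  have h2 : t * (t * (x ⬝ᵥ (S *ᵥ x))) ≤ 1 := by
    calc t * (t * (x ⬝ᵥ (S *ᵥ x))) = t ^ 2 * (x ⬝ᵥ (S *ᵥ x)) := by ring
      _ ≤ t ^ 2 * (u ⬝ᵥ x) ^ 2 := by gcongr
      _ = 1 := by rw [← mul_pow, h1, one_pow]
  nlinarith [hS.det_pos]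

/-- The order of `ι` is the order of insertion; each vector doubles the determinant of the form
built before it. -/
theorem two_pow_card_mul_det_le {ι : Type*} [LinearOrder ι] {d : ℕ}
    {S : Matrix (Fin d) (Fin d) ℝ} (hS : S.PosDef) (u x : ι → Fin d → ℝ) (I : Finset ι)
    (hux : ∀ i ∈ I, u i ⬝ᵥ x i ≠ 0)
    (h : ∀ i ∈ I, x i ⬝ᵥ (S *ᵥ x i) + ∑ j ∈ I with j < i, (u j ⬝ᵥ x i) ^ 2 ≤ (u i ⬝ᵥ x i) ^ 2) :
    2 ^ I.card * S.det ≤ (S + ∑ i ∈ I, vecMulVec (u i) (u i)).det := by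
  induction I using Finset.induction_on_max with
  | empty => simp
  | insert a I ha ih =>
    have haI : a ∉ I := fun hmem => lt_irrefl _ (ha a hmem)
    have ih' := ih (fun i hi => hux i (Finset.mem_insert_of_mem hi)) (fun i hi => by
      have := h i (Finset.mem_insert_of_mem hi)
      rwa [Finset.filter_insert, if_neg (not_lt.2 (ha i hi).le)] at this)
    have hpd : (S + ∑ i ∈ I, vecMulVec (u i) (u i)).PosDef :=
      hS.add_posSemidef (posSemidef_sum _ fun i _ => posSemidef_vecMulVec_self (u i))
    have hlast : x a ⬝ᵥ ((S + ∑ i ∈ I, vecMulVec (u i) (u i)) *ᵥ x a) ≤ (u a ⬝ᵥ x a) ^ 2 := by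
      have := h a (Finset.mem_insert_self a I)
      rw [Finset.filter_insert, if_neg (lt_irrefl a), Finset.filter_true_of_mem ha] at this
      simpa [add_mulVec, sum_mulVec, dotProduct_add, dotProduct_sum,
        dotProduct_vecMulVec_mulVec] using this
    have hstep := hpd.two_mul_det_le_det_add_vecMulVec (hux a (Finset.mem_insert_self a I)) hlast
    rw [Finset.card_insert_of_notMem haI, Finset.sum_insert haI, pow_succ,
      add_comm (vecMulVec _ _), ← add_assoc]
    linarith

/-- The potential argument with the identity as the base form. -/
theorem two_pow_card_le_of_one {ι : Type*} [LinearOrder ι] {d : ℕ} (hd : 0 < d) {δ K : ℝ}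
    (hδ : 0 < δ) (u x : ι → Fin d → ℝ) (I : Finset ι) (hK : ∀ i ∈ I, u i ⬝ᵥ u i ≤ K)
    (hux : ∀ i ∈ I, u i ⬝ᵥ x i ≠ 0)
    (h : ∀ i ∈ I, δ * (x i ⬝ᵥ x i) + ∑ j ∈ I with j < i, (u j ⬝ᵥ x i) ^ 2 ≤ (u i ⬝ᵥ x i) ^ 2) :
    (2 : ℝ) ^ I.card ≤ (1 + I.card * K / (δ * d)) ^ d := by
  have hd' : (0 : ℝ) < d := by exact_mod_cast hd
  have hS : (δ • (1 : Matrix (Fin d) (Fin d) ℝ)).PosDef := Matrix.PosDef.one.smul hδ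
  have hlow := two_pow_card_mul_det_le hS u x I hux (by simpa [smul_mulVec] using h)
  have hpd : (δ • (1 : Matrix (Fin d) (Fin d) ℝ) + ∑ i ∈ I, vecMulVec (u i) (u i)).PosDef :=
    hS.add_posSemidef (posSemidef_sum _ fun i _ => posSemidef_vecMulVec_self (u i))
  have hup := hpd.posSemidef.det_le_trace_div_pow hd
  have htr : (δ • (1 : Matrix (Fin d) (Fin d) ℝ) + ∑ i ∈ I, vecMulVec (u i) (u i)).trace
      = δ * d + ∑ i ∈ I, u i ⬝ᵥ u i := by
    simp [trace_add, trace_smul, trace_sum, trace_vecMulVec]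
  have hsum : ∑ i ∈ I, u i ⬝ᵥ u i ≤ I.card * K := by
    simpa using Finset.sum_le_sum hK
  have hsum0 : 0 ≤ ∑ i ∈ I, u i ⬝ᵥ u i :=
    Finset.sum_nonneg fun i _ => by simpa using dotProduct_star_self_nonneg (u i)
  have hdet : (δ • (1 : Matrix (Fin d) (Fin d) ℝ)).det = δ ^ d := by simp
  rw [hdet] at hlow
  rw [htr] at hup
  have hfin : (2 : ℝ) ^ I.card * δ ^ d ≤ (1 + I.card * K / (δ * d)) ^ d * δ ^ d := by
    rw [← mul_pow]
    refine (hlow.trans hup).trans (pow_le_pow_left₀ (by positivity) ?_ d)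
    rw [div_le_iff₀ hd']
    have : (1 + I.card * K / (δ * d)) * δ * d = δ * d + I.card * K := by field_simp
    linarith
  exact le_of_mul_le_mul_right hfin (by positivity)

open scoped MatrixOrder in
theorem Matrix.PosDef.exists_isUnit_symm_mul_self {d : ℕ} {T : Matrix (Fin d) (Fin d) ℝ}
    (hT : T.PosDef) : ∃ R : Matrix (Fin d) (Fin d) ℝ, Rᵀ = R ∧ IsUnit R.det ∧ R * R = T := by
  have h0 : 0 ≤ T := nonneg_iff_posSemidef.2 hT.posSemidef
  have hmul : CFC.sqrt T * CFC.sqrt T = T := CFC.sqrt_mul_sqrt_self T h0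
  refine ⟨CFC.sqrt T, ?_, ?_, hmul⟩
  · have := (nonneg_iff_posSemidef.1 (CFC.sqrt_nonneg T)).1.eq
    simpa using this
  · have hd := hT.det_pos
    rw [← hmul, det_mul] at hd
    exact (left_ne_zero_of_mul hd.ne').isUnit

/-- Whitening: with `R² = T`, replacing `u` by `R⁻¹ u` and `x` by `R x` preserves all pairings and
turns `T` into the identity. -/
theorem Matrix.PosDef.two_pow_card_le {ι : Type*} [LinearOrder ι] {d : ℕ} (hd : 0 < d)
    {T : Matrix (Fin d) (Fin d) ℝ} (hT : T.PosDef) {δ K : ℝ}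
    (hδ : 0 < δ) (hK0 : 0 ≤ K) (u x : ι → Fin d → ℝ) (I : Finset ι)
    (hK : ∀ i ∈ I, ∀ y, (u i ⬝ᵥ y) ^ 2 ≤ K * (y ⬝ᵥ (T *ᵥ y)))
    (hux : ∀ i ∈ I, u i ⬝ᵥ x i ≠ 0)
    (h : ∀ i ∈ I, δ * (x i ⬝ᵥ (T *ᵥ x i)) + ∑ j ∈ I with j < i, (u j ⬝ᵥ x i) ^ 2
      ≤ (u i ⬝ᵥ x i) ^ 2) :
    (2 : ℝ) ^ I.card ≤ (1 + I.card * K / (δ * d)) ^ d := by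
  obtain ⟨R, hsym, hR, hRR⟩ := hT.exists_isUnit_symm_mul_self
  have hquad : ∀ y, y ⬝ᵥ (T *ᵥ y) = (R *ᵥ y) ⬝ᵥ (R *ᵥ y) := fun y => by
    rw [← hRR, ← mulVec_mulVec, dotProduct_mulVec, ← mulVec_transpose, hsym]
  have hRinv : ∀ w, R *ᵥ (R⁻¹ *ᵥ w) = w := fun w => by
    simp [mulVec_mulVec, mul_nonsing_inv _ hR]
  have hprod : ∀ w y, (R⁻¹ *ᵥ w) ⬝ᵥ (R *ᵥ y) = w ⬝ᵥ y := fun w y => by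
    rw [dotProduct_mulVec, ← mulVec_transpose, hsym, hRinv]
  refine two_pow_card_le_of_one hd hδ (fun i => R⁻¹ *ᵥ u i) (fun i => R *ᵥ x i) I
    (fun i hi => ?_) (fun i hi => by simpa only [hprod] using hux i hi)
    (fun i hi => by simpa only [hprod, ← hquad] using h i hi)
  -- At this point the bound `hK` becomes `|R⁻¹ u|⁴ ≤ K |R⁻¹ u|²`, and one factor cancels unless it
  -- vanishes.
  have h1 := hK i hi (R⁻¹ *ᵥ (R⁻¹ *ᵥ u i))
  rw [hquad, hRinv, ← hprod, hRinv, sq] at h1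
  rcases (dotProduct_star_self_nonneg (R⁻¹ *ᵥ u i)).lt_or_eq with hpos | hz
  · rw [star_trivial] at hpos
    exact le_of_mul_le_mul_right h1 hpos
  · rw [star_trivial] at hz
    rw [← hz]; exact hK0

/-- Vectors `u i`, each of which sticks out, in the direction `x i`, of the ellipsoid of the base
family `w` and of the earlier vectors, are few. -/
theorem two_pow_card_le {ι κ : Type*} [LinearOrder ι] {d : ℕ} (hd : 0 < d) {δ K : ℝ}
    (hδ : 0 < δ) (hK0 : 0 ≤ K) (w : κ → Fin d → ℝ) (W : Finset κ) (u x : ι → Fin d → ℝ)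
    (I : Finset ι) (hK : ∀ i ∈ I, ∀ y, (u i ⬝ᵥ y) ^ 2 ≤ K * ∑ k ∈ W, (w k ⬝ᵥ y) ^ 2)
    (h : ∀ i ∈ I, δ * ∑ k ∈ W, (w k ⬝ᵥ x i) ^ 2 + ∑ j ∈ I with j < i, (u j ⬝ᵥ x i) ^ 2
      < (u i ⬝ᵥ x i) ^ 2) :
    (2 : ℝ) ^ I.card ≤ (1 + I.card * K / (δ * d)) ^ d := by
  -- The Gram form of `W` may be degenerate. Finitely many strict inequalities leave room for adding
  -- a small multiple of the identity.
  have hη : ∃ η > 0, ∀ i ∈ I, δ * (η * (x i ⬝ᵥ x i) + ∑ k ∈ W, (w k ⬝ᵥ x i) ^ 2)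
      + ∑ j ∈ I with j < i, (u j ⬝ᵥ x i) ^ 2 ≤ (u i ⬝ᵥ x i) ^ 2 := by
    have hev : ∀ᶠ η in nhdsWithin (0 : ℝ) (Set.Ioi 0), ∀ i ∈ I,
        δ * (η * (x i ⬝ᵥ x i) + ∑ k ∈ W, (w k ⬝ᵥ x i) ^ 2)
        + ∑ j ∈ I with j < i, (u j ⬝ᵥ x i) ^ 2 ≤ (u i ⬝ᵥ x i) ^ 2 := by
      refine (Filter.eventually_all_finset I).2 fun i hi => ?_
      have hc : Continuous fun η : ℝ => δ * (η * (x i ⬝ᵥ x i) + ∑ k ∈ W, (w k ⬝ᵥ x i) ^ 2)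
        + ∑ j ∈ I with j < i, (u j ⬝ᵥ x i) ^ 2 := by fun_prop
      have := (hc.tendsto 0).mono_left (nhdsWithin_le_nhds (s := Set.Ioi 0))
      exact (this.eventually_lt_const (by simpa using h i hi)).mono fun _ => le_of_lt
    obtain ⟨η, hη, hpos⟩ := (hev.and self_mem_nhdsWithin).exists
    exact ⟨η, hpos, hη⟩
  obtain ⟨η, hη0, hη⟩ := hη
  have hT : (η • (1 : Matrix (Fin d) (Fin d) ℝ) + ∑ k ∈ W, vecMulVec (w k) (w k)).PosDef :=
    (Matrix.PosDef.one.smul hη0).add_posSemidef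
      (posSemidef_sum _ fun i _ => posSemidef_vecMulVec_self (w i))
  have hquad : ∀ y, y ⬝ᵥ ((η • (1 : Matrix (Fin d) (Fin d) ℝ)
      + ∑ k ∈ W, vecMulVec (w k) (w k)) *ᵥ y)
      = η * (y ⬝ᵥ y) + ∑ k ∈ W, (w k ⬝ᵥ y) ^ 2 := fun y => by
    simp [add_mulVec, sum_mulVec, smul_mulVec, dotProduct_add, dotProduct_sum,
      dotProduct_vecMulVec_mulVec]
  refine hT.two_pow_card_le hd hδ hK0 u x I (fun i hi y => ?_) (fun i hi h0 => ?_) fun i hi => ?_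
  · rw [hquad]
    refine (hK i hi y).trans (mul_le_mul_of_nonneg_left ?_ hK0)
    have : 0 ≤ y ⬝ᵥ y := by simpa using dotProduct_star_self_nonneg y
    nlinarith
  · have := h i hi
    rw [h0] at this
    have h1 : 0 ≤ δ * ∑ k ∈ W, (w k ⬝ᵥ x i) ^ 2 := by positivity
    have h2 : 0 ≤ ∑ j ∈ I with j < i, (u j ⬝ᵥ x i) ^ 2 := by positivity
    norm_num at this
    linarith
  · rw [hquad]; exact hη i hi

/-! ### From the determinant inequality to a bound of order `d log d`. -/

theorem le_of_two_pow_le {d h : ℕ} (hd : 2 ≤ d) (hh : (2 : ℝ) ^ h ≤ (1 + 4 * h ^ 2 / d) ^ d) :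
    (h : ℝ) ≤ 30 * (d * Real.log d) := by
  have hd2 : (2 : ℝ) ≤ d := by exact_mod_cast hd
  have hd0 : (0 : ℝ) < d := by linarith
  have hl2 := Real.log_two_gt_d9
  have hl2' := Real.log_two_lt_d9
  have hL : Real.log 2 ≤ Real.log d := Real.log_le_log (by norm_num) hd2
  set z : ℝ := h / d with hz
  have hz0 : 0 ≤ z := by positivity
  have hhz : (h : ℝ) = d * z := by rw [hz]; field_simp
  have h1 : h * Real.log 2 ≤ d * Real.log (1 + 4 * h ^ 2 / d) := by
    have := Real.log_le_log (by positivity) hh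
    rwa [Real.log_pow, Real.log_pow] at this
  have h2 : z * Real.log 2 ≤ Real.log (1 + 4 * h ^ 2 / d) := by
    rw [hhz, mul_assoc] at h1
    rw [hhz]
    exact le_of_mul_le_mul_left h1 hd0
  have h3 : (1 + 4 * (h : ℝ) ^ 2 / d) ≤ d * (1 + 2 * z) ^ 2 := by
    have : 4 * (h : ℝ) ^ 2 / d = 4 * d * z ^ 2 := by rw [hhz]; field_simp
    rw [this]; nlinarith
  have h4 : Real.log (1 + 4 * h ^ 2 / d) ≤ Real.log d + 2 * Real.log (1 + 2 * z) := by
    refine (Real.log_le_log (by positivity) h3).trans_eq ?_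
    rw [Real.log_mul hd0.ne' (by positivity), Real.log_pow]; norm_num
  -- Tangent of the logarithm at 16: twice its slope in `z` is `1/4 < log 2`, so the linear term can
  -- be absorbed on the left, and `log 16 = 4 log 2`.
  have h5 : Real.log (1 + 2 * z) ≤ (1 + 2 * z) / 16 - 1 + 4 * Real.log 2 := by
    have e : Real.log (1 + 2 * z) = Real.log ((1 + 2 * z) / 16) + 4 * Real.log 2 := by
      rw [Real.log_div (by positivity) (by norm_num), show (16 : ℝ) = 2 ^ 4 by norm_num,
        Real.log_pow]
      norm_num
    have := Real.log_le_sub_one_of_pos (show 0 < (1 + 2 * z) / 16 by positivity)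
    linarith
  have h6 : z ≤ 30 * Real.log d := by nlinarith
  rw [hhz]
  nlinarith

/-! ### Spectral spanners in terms of quadratic forms -/

theorem posSemidef_smul_sum_sub_iff {d : ℕ} (α : ℝ) (U : Finset (Fin d → ℝ))
    (μ : (Fin d → ℝ) → ℝ) (v : Fin d → ℝ) :
    (α • ∑ u ∈ U, μ u • vecMulVec u u - vecMulVec v v).PosSemidef ↔
      ∀ x, (v ⬝ᵥ x) ^ 2 ≤ α * ∑ u ∈ U, μ u * (u ⬝ᵥ x) ^ 2 := by
  have hquad : ∀ x, x ⬝ᵥ ((α • ∑ u ∈ U, μ u • vecMulVec u u - vecMulVec v v) *ᵥ x)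
      = α * ∑ u ∈ U, μ u * (u ⬝ᵥ x) ^ 2 - (v ⬝ᵥ x) ^ 2 := fun x => by
    simp [sub_mulVec, smul_mulVec, sum_mulVec, dotProduct_sub, dotProduct_sum,
      dotProduct_vecMulVec_mulVec]
  have hherm : (α • ∑ u ∈ U, μ u • vecMulVec u u - vecMulVec v v).IsHermitian := by
    ext i j
    simp [Matrix.sum_apply, vecMulVec_apply, mul_comm]
  rw [posSemidef_iff_dotProduct_mulVec]
  simp only [star_trivial, hquad, sub_nonneg, hherm, true_and]

theorem isSpectralSpanner_iff {d : ℕ} {α : ℝ} {V U : Finset (Fin d → ℝ)} :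
    IsSpectralSpanner α V U ↔ U ⊆ V ∧ ∀ v ∈ V, ∃ μ : (Fin d → ℝ) → ℝ,
      (∀ u ∈ U, 0 ≤ μ u) ∧ ∑ u ∈ U, μ u = 1 ∧
      ∀ x, (v ⬝ᵥ x) ^ 2 ≤ α * ∑ u ∈ U, μ u * (u ⬝ᵥ x) ^ 2 := by
  simp only [IsSpectralSpanner, posSemidef_smul_sum_sub_iff]

/-! ### The output of the greedy algorithm -/

theorem isCompact_setOf_sum_abs_le {ι : Type*} [Fintype ι] (r : ℝ) :
    IsCompact {c : ι → ℝ | ∑ i, |c i| ≤ r} := by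
  refine Metric.isCompact_of_isClosed_isBounded (isClosed_le (by fun_prop) continuous_const) ?_
  refine (Metric.isBounded_closedBall (x := (0 : ι → ℝ)) (r := max r 0)).subset fun c hc => ?_
  rw [mem_closedBall_zero_iff, pi_norm_le_iff_of_nonneg (le_max_right _ _)]
  intro i
  exact ((Finset.single_le_sum (f := fun i => |c i|) (fun j _ => abs_nonneg _)
    (Finset.mem_univ i)).trans hc).trans (le_max_left _ _)

theorem convex_setOf_sum_abs_le {ι : Type*} [Fintype ι] (r : ℝ) :
    Convex ℝ {c : ι → ℝ | ∑ i, |c i| ≤ r} := by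
  intro c hc e he a b ha hb hab
  simp only [Set.mem_ofPred_eq] at hc he ⊢
  calc ∑ i, |(a • c + b • e) i| ≤ ∑ i, (a * |c i| + b * |e i|) := by
        refine Finset.sum_le_sum fun i _ => (abs_add_le _ _).trans_eq ?_
        simp [abs_mul, abs_of_nonneg ha, abs_of_nonneg hb]
    _ = a * ∑ i, |c i| + b * ∑ i, |e i| := by
        rw [Finset.sum_add_distrib, Finset.mul_sum, Finset.mul_sum]
    _ ≤ a * r + b * r := by gcongr
    _ = r := by rw [← add_mul, hab, one_mul]

/-- A vector that has no bad direction is a short combination of the vectors of `U`. -/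
theorem exists_sum_smul_eq_of_badDirections_eq_empty {d : ℕ} {α : ℝ} {U : Finset (Fin d → ℝ)}
    {v : Fin d → ℝ} (h : badDirections α U v = ∅) :
    ∃ c : U → ℝ, ∑ u, |c u| ≤ √α ∧ ∑ u, c u • (u : Fin d → ℝ) = v := by
  by_contra hcon
  push Not at hcon
  let L : (U → ℝ) →ₗ[ℝ] (Fin d → ℝ) := ∑ u : U, (LinearMap.proj u).smulRight (u : Fin d → ℝ)
  have hL : ∀ c, L c = ∑ u, c u • (u : Fin d → ℝ) := fun c => by simp [L]
  set B := {c : U → ℝ | ∑ u, |c u| ≤ √α} with hB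
  have hconv : Convex ℝ (L '' B) := (convex_setOf_sum_abs_le _).linear_image L
  have hclosed : IsClosed (L '' B) :=
    ((isCompact_setOf_sum_abs_le _).image L.continuous_of_finiteDimensional).isClosed
  have hv : v ∉ L '' B := by
    rintro ⟨c, hc, hcv⟩
    exact hcon c hc ((hL c).symm.trans hcv)
  -- The combinations with coefficient sum at most `√α` form a compact convex set. A functional
  -- separating `v` from it, tested on the points `±√α u`, is a bad direction.
  obtain ⟨f, s, hfs, hsv⟩ := geometric_hahn_banach_closed_point hconv hclosed hv
  let x : Fin d → ℝ := fun j => f (Pi.single j 1)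
  have hx : ∀ y, f y = x ⬝ᵥ y := fun y => by
    conv_lhs => rw [pi_eq_sum_univ' y]
    simp [x, dotProduct, mul_comm]
  have hmem : x ∈ badDirections α U v := by
    intro u hu
    have key : ∀ r : ℝ, |r| ≤ √α → r * (x ⬝ᵥ u) < x ⬝ᵥ v := fun r hr => by
      have := hfs (L (Pi.single ⟨u, hu⟩ r)) ⟨_, by
        simp only [hB, Set.mem_ofPred_eq]
        rwa [Finset.sum_eq_single ⟨u, hu⟩ (fun b _ hb => by simp [Pi.single_eq_of_ne hb])
          (by simp), Pi.single_eq_same], rfl⟩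
      rw [hL, Finset.sum_eq_single ⟨u, hu⟩ (fun b _ hb => by simp [Pi.single_eq_of_ne hb])
          (by simp), Pi.single_eq_same, map_smul, hx, smul_eq_mul] at this
      rw [← hx v]
      exact this.trans hsv
    rcases abs_cases (x ⬝ᵥ u) with ⟨e, _⟩ | ⟨e, _⟩
    · rw [e]; exact key _ (by rw [abs_of_nonneg (Real.sqrt_nonneg _)])
    · rw [e]
      have := key (-√α) (by rw [abs_neg, abs_of_nonneg (Real.sqrt_nonneg _)])
      linarith
  rw [h] at hmem
  exact hmem

/-- For `v = ∑ c_u u` with `σ = ∑ |c_u| ≤ √α`, Cauchy-Schwarz gives `⟨v, x⟩² ≤ σ ∑ |c_u| ⟨u, x⟩²`,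
and the weights `|c_u| / √α` turn this into the factor `α`. -/
theorem isSpectralSpanner_of_greedyStops {d : ℕ} {α : ℝ} (hα : 0 < α)
    {V U : Finset (Fin d → ℝ)} (hUV : U ⊆ V) (h : GreedyStops α V U) :
    IsSpectralSpanner α V U := by
  refine isSpectralSpanner_iff.2 ⟨hUV, fun v hv => ?_⟩
  have hU : U.Nonempty := by
    rw [Finset.nonempty_iff_ne_empty]
    rintro rfl
    -- Over an empty `U` the condition on a bad direction is vacuous, so even 0 is one.
    have : (0 : Fin d → ℝ) ∈ badDirections α ∅ v := by simp [badDirections]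
    rw [h v hv] at this
    exact this
  obtain ⟨c, hc, rfl⟩ := exists_sum_smul_eq_of_badDirections_eq_empty (h v hv)
  have hr : 0 < √α := Real.sqrt_pos.2 hα
  have hcard : (0 : ℝ) < U.card := by exact_mod_cast hU.card_pos
  set σ := ∑ u, |c u| with hσ
  set c' : (Fin d → ℝ) → ℝ := fun u => if hu : u ∈ U then |c ⟨u, hu⟩| else 0 with hc'
  have hc'u : ∀ u : U, c' u = |c u| := fun u => by simp [hc']
  have hc'0 : ∀ u, 0 ≤ c' u := fun u => by
    simp only [hc']; split_ifs <;> positivity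
  have hsl : 0 ≤ 1 - σ / √α := sub_nonneg.2 ((div_le_one hr).2 hc)
  have hσ' : ∑ u ∈ U, c' u = σ := by
    rw [← Finset.sum_coe_sort U c']; exact Finset.sum_congr rfl fun u _ => hc'u u
  -- The weights `|c_u| / √α` have total mass at most 1; the missing mass is spread uniformly, which
  -- only enlarges the form.
  refine ⟨fun u => c' u / √α + (1 - σ / √α) / U.card, fun u _ => ?_, ?_, fun x => ?_⟩
  · have := hc'0 u
    positivity
  · rw [Finset.sum_add_distrib, ← Finset.sum_div, hσ', Finset.sum_const, nsmul_eq_mul]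
    field_simp
    ring
  · have e1 : (∑ u : U, c u • (u : Fin d → ℝ)) ⬝ᵥ x = ∑ u : U, c u * ((u : Fin d → ℝ) ⬝ᵥ x) := by
      simp [sum_dotProduct]
    have e2 : ∑ u ∈ U, c' u * (u ⬝ᵥ x) ^ 2 = ∑ u : U, |c u| * ((u : Fin d → ℝ) ⬝ᵥ x) ^ 2 := by
      rw [← Finset.sum_coe_sort U]; exact Finset.sum_congr rfl fun u _ => by rw [hc'u u]
    have hcs : (∑ u : U, c u * ((u : Fin d → ℝ) ⬝ᵥ x)) ^ 2
        ≤ σ * ∑ u : U, |c u| * ((u : Fin d → ℝ) ⬝ᵥ x) ^ 2 := by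
      refine Finset.sum_sq_le_sum_mul_sum_of_sq_le_mul _ (fun u _ => abs_nonneg _)
        (fun u _ => by positivity) fun u _ => le_of_eq ?_
      rw [← sq_abs, abs_mul, mul_pow, sq_abs (_ ⬝ᵥ _)]
      ring
    have hT : 0 ≤ ∑ u ∈ U, c' u * (u ⬝ᵥ x) ^ 2 :=
      Finset.sum_nonneg fun u _ => mul_nonneg (hc'0 u) (sq_nonneg _)
    have hge : ∑ u ∈ U, c' u / √α * (u ⬝ᵥ x) ^ 2
        ≤ ∑ u ∈ U, (c' u / √α + (1 - σ / √α) / U.card) * (u ⬝ᵥ x) ^ 2 := by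
      gcongr with u
      have : 0 ≤ (1 - σ / √α) / U.card := by positivity
      linarith
    have e3 : α * ∑ u ∈ U, c' u / √α * (u ⬝ᵥ x) ^ 2 = √α * ∑ u ∈ U, c' u * (u ⬝ᵥ x) ^ 2 := by
      rw [Finset.mul_sum, Finset.mul_sum]
      refine Finset.sum_congr rfl fun u _ => ?_
      nth_rewrite 1 [← Real.mul_self_sqrt hα.le]
      field_simp
    rw [e1]
    calc _ ≤ σ * ∑ u ∈ U, c' u * (u ⬝ᵥ x) ^ 2 := by rw [e2]; exact hcs
      _ ≤ √α * ∑ u ∈ U, c' u * (u ⬝ᵥ x) ^ 2 := by gcongr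
      _ = α * ∑ u ∈ U, c' u / √α * (u ⬝ᵥ x) ^ 2 := e3.symm
      _ ≤ _ := by gcongr

/-! ### The number of iterations of the greedy algorithm -/

/-- The history of a run of the greedy algorithm. -/
theorem GreedyRun.exists_history {d : ℕ} {α : ℝ} (hα : 0 ≤ α) {V U : Finset (Fin d → ℝ)} {k : ℕ}
    (h : GreedyRun α V k U) :
    ∃ u x : ℕ → Fin d → ℝ, U = (Finset.range k).image u ∧ ∀ i < k, u i ∈ V ∧
      (∀ w ∈ V, (w ⬝ᵥ x i) ^ 2 ≤ (u i ⬝ᵥ x i) ^ 2) ∧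
      ∀ j < i, α * (u j ⬝ᵥ x i) ^ 2 < (u i ⬝ᵥ x i) ^ 2 := by
  induction h with
  | start => exact ⟨0, 0, by simp, by simp⟩
  | @iterate k U v x w hrun hv hx hw hmax ih =>
    obtain ⟨u, y, rfl, huy⟩ := ih
    refine ⟨Function.update u k w, Function.update y k x, ?_, fun i hi => ?_⟩
    · rw [Finset.range_add_one, Finset.image_insert, Function.update_self]
      congr 1
      refine Finset.image_congr fun i hi => ?_
      rw [Function.update_of_ne (by simpa using ne_of_lt (by simpa using hi))]
    · rcases Nat.lt_succ_iff_lt_or_eq.1 hi with hi | rfl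
      · rw [Function.update_of_ne hi.ne, Function.update_of_ne hi.ne]
        obtain ⟨h1, h2, h3⟩ := huy i hi
        refine ⟨h1, h2, fun j hj => ?_⟩
        rw [Function.update_of_ne (hj.trans hi).ne]
        exact h3 j hj
      · rw [Function.update_self, Function.update_self]
        refine ⟨hw, hmax, fun j hj => ?_⟩
        rw [Function.update_of_ne hj.ne]
        -- The bad direction compares `v` with `u j`; maximality of `w` then replaces `v` by `w`.
        have h1 := hx (u j) (Finset.mem_image_of_mem u (by simpa using hj))
        have h2 : (√α * |x ⬝ᵥ u j|) ^ 2 < (x ⬝ᵥ v) ^ 2 :=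
          pow_lt_pow_left₀ h1 (by positivity) two_ne_zero
        rw [mul_pow, Real.sq_sqrt hα, sq_abs, dotProduct_comm x (u j), dotProduct_comm x v] at h2
        exact h2.trans_le (hmax v hv)

theorem GreedyRun.subset {d : ℕ} {α : ℝ} {V U : Finset (Fin d → ℝ)} {k : ℕ}
    (h : GreedyRun α V k U) : U ⊆ V := by
  induction h with
  | start => simp
  | iterate _ _ _ hw _ ih => exact Finset.insert_subset hw ih

theorem GreedyRun.card_le {d : ℕ} {α : ℝ} {V U : Finset (Fin d → ℝ)} {k : ℕ}
    (h : GreedyRun α V k U) : U.card ≤ k := by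
  induction h with
  | start => simp
  | iterate _ _ _ _ _ ih => exact (Finset.card_insert_le _ _).trans (by omega)

/-- The base form is the Gram form of `u 1, …, u h`, hence `K = 1`. With `q = ⟨u i, x i⟩²`,
maximality bounds it at `x i` by `h q`, so `δ = 1 / (4 h)` leaves at most `q / 4`; the earlier
vectors contribute at most `h q / α ≤ q / 2`. -/
theorem GreedyRun.two_pow_le {d : ℕ} (hd : 0 < d) {α : ℝ} {V U : Finset (Fin d → ℝ)} {k : ℕ}
    (hrun : GreedyRun α V k U) {h : ℕ} (hh : 0 < h) (hhk : h < k) (hα : 2 * h ≤ α) :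
    (2 : ℝ) ^ h ≤ (1 + 4 * h ^ 2 / d) ^ d := by
  have hh0 : (0 : ℝ) < h := by exact_mod_cast hh
  have hα0 : 0 < α := by linarith
  obtain ⟨u, x, -, hux⟩ := hrun.exists_history hα0.le
  -- Index 0 is left out: for `i ≥ 1` the strict comparison with `u 0` yields `q > 0`.
  have key := two_pow_card_le hd (δ := 1 / (4 * h)) (K := 1) (by positivity) zero_le_one u
    (Finset.Icc 1 h) u x (Finset.Icc 1 h) (fun i hi y => ?_) fun i hi => ?_
  · rw [Nat.card_Icc, Nat.add_sub_cancel] at key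
    refine key.trans_eq ?_
    congr 2
    field_simp
  · rw [one_mul]
    exact Finset.single_le_sum (f := fun k => (u k ⬝ᵥ y) ^ 2) (fun _ _ => sq_nonneg _) hi
  · rw [Finset.mem_Icc] at hi
    obtain ⟨-, hmax, hlt⟩ := hux i (by omega)
    set q := (u i ⬝ᵥ x i) ^ 2 with hq
    have hq0 : 0 < q := lt_of_le_of_lt (by positivity) (hlt 0 (by omega))
    have h1 : ∑ k ∈ Finset.Icc 1 h, (u k ⬝ᵥ x i) ^ 2 ≤ h * q := by
      have := Finset.sum_le_card_nsmul (Finset.Icc 1 h) (fun k => (u k ⬝ᵥ x i) ^ 2) q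
        fun k hk => hmax _ (hux k (by rw [Finset.mem_Icc] at hk; omega)).1
      simpa using this
    have h2 : ∑ j ∈ Finset.Icc 1 h with j < i, (u j ⬝ᵥ x i) ^ 2 ≤ h * (q / α) := by
      have := Finset.sum_le_card_nsmul ((Finset.Icc 1 h).filter (· < i))
        (fun k => (u k ⬝ᵥ x i) ^ 2) (q / α) fun k hk => by
          rw [le_div_iff₀ hα0, mul_comm]
          exact (hlt k (Finset.mem_filter.1 hk).2).le
      rw [nsmul_eq_mul] at this
      refine this.trans ?_
      gcongr
      exact (Finset.card_filter_le _ _).trans (by simp)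
    have h3 : h * (q / α) ≤ q / 2 := by
      rw [mul_div_assoc', div_le_iff₀ hα0]
      nlinarith
    have h4 : 1 / (4 * (h : ℝ)) * ∑ k ∈ Finset.Icc 1 h, (u k ⬝ᵥ x i) ^ 2 ≤ q / 4 := by
      refine (mul_le_mul_of_nonneg_left h1 (by positivity)).trans_eq ?_
      field_simp
    linarith

theorem one_le_mul_log {d : ℕ} (hd : 2 ≤ d) : 1 ≤ d * Real.log d := by
  have hd2 : (2 : ℝ) ≤ d := by exact_mod_cast hd
  have hL : Real.log 2 ≤ Real.log d := Real.log_le_log (by norm_num) hd2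
  have hl2 := Real.log_two_gt_d9
  nlinarith

/-- Source of the constant 93: `2 · 31 = 62`, and `62 ≤ 93 log d` because `log 2 > 2/3`. -/
theorem two_mul_le_mul_log_sq {d : ℕ} (hd : 2 ≤ d) {y : ℝ} (hy : y ≤ 31 * (d * Real.log d)) :
    2 * y ≤ 93 * (d * Real.log d ^ 2) := by
  have hd2 : (2 : ℝ) ≤ d := by exact_mod_cast hd
  have hL : Real.log 2 ≤ Real.log d := Real.log_le_log (by norm_num) hd2
  have hl2 := Real.log_two_gt_d9
  have h1 := one_le_mul_log hd
  nlinarith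

theorem GreedyRun.le_mul_log {d : ℕ} (hd : 2 ≤ d) {V U : Finset (Fin d → ℝ)} {k : ℕ}
    (hrun : GreedyRun (93 * (d * Real.log d ^ 2)) V k U) :
    (k : ℝ) ≤ 93 * (d * Real.log d) := by
  by_contra! hk
  have h1 := one_le_mul_log hd
  -- The least integer above `30 d log d` contradicts `le_of_two_pow_le`, while `1 ≤ d log d` keeps
  -- it below `31 d log d`, so that `2 h ≤ α` and `h < k`.
  set h := ⌊30 * (d * Real.log d)⌋₊ + 1 with hh
  have hfl : (⌊30 * (d * Real.log d)⌋₊ : ℝ) ≤ 30 * (d * Real.log d) :=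
    Nat.floor_le (by linarith)
  have hlt : 30 * (d * Real.log d) < h := by rw [hh]; exact_mod_cast Nat.lt_floor_add_one _
  have hle : (h : ℝ) ≤ 31 * (d * Real.log d) := by rw [hh]; push_cast; linarith
  have hhk : h < k := by exact_mod_cast (show (h : ℝ) < k by linarith)
  have := le_of_two_pow_le hd (hrun.two_pow_le (by omega) (h := h) (by omega) hhk
    (two_mul_le_mul_log_sq hd hle))
  linarith

/-! ### Nearly orthogonal vectors -/

/-- Test at `x = v`: if `v ∉ U`, the average of `⟨u, v⟩²` over `U` is below `β`, so `⟨v, v⟩² < α β`.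
-/
theorem IsSpectralSpanner.mem_of_sq_lt {d : ℕ} {α β : ℝ} {V U : Finset (Fin d → ℝ)}
    (h : IsSpectralSpanner α V U) (hα : 0 < α) {v : Fin d → ℝ} (hv : v ∈ V)
    (hβ : α * β ≤ (v ⬝ᵥ v) ^ 2) (hlt : ∀ u ∈ V, u ≠ v → (u ⬝ᵥ v) ^ 2 < β) : v ∈ U := by
  by_contra hvU
  obtain ⟨hUV, hspan⟩ := isSpectralSpanner_iff.1 h
  obtain ⟨μ, hμ0, hμ1, hμ⟩ := hspan v hv
  have hex : ∃ u ∈ U, 0 < μ u := by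
    by_contra! hcon
    have := Finset.sum_nonpos hcon
    linarith
  have hsum : ∑ u ∈ U, μ u * (u ⬝ᵥ v) ^ 2 < ∑ u ∈ U, μ u * β := by
    have hltU : ∀ u ∈ U, (u ⬝ᵥ v) ^ 2 < β := fun u hu =>
      hlt u (hUV hu) fun e => hvU (e ▸ hu)
    refine Finset.sum_lt_sum (fun u hu => mul_le_mul_of_nonneg_left (hltU u hu).le (hμ0 u hu)) ?_
    obtain ⟨u, hu, hpos⟩ := hex
    exact ⟨u, hu, mul_lt_mul_of_pos_left (hltU u hu) hpos⟩
  rw [← Finset.sum_mul, hμ1, one_mul] at hsum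
  have := hμ v
  nlinarith

theorem IsSpectralSpanner.eq_of_nearly_orthogonal {d : ℕ} {α β q : ℝ} {V U : Finset (Fin d → ℝ)}
    (h : IsSpectralSpanner α V U) (hα : 0 < α) (hq : ∀ v ∈ V, v ⬝ᵥ v = q) (hβ : α * β ≤ q ^ 2)
    (hlt : ∀ v ∈ V, ∀ u ∈ V, u ≠ v → (u ⬝ᵥ v) ^ 2 < β) : U = V :=
  Finset.Subset.antisymm h.1 fun v hv =>
    h.mem_of_sq_lt hα hv (by rwa [hq v hv]) (hlt v hv)

theorem rpow_one_sub_mul_rpow_one_add {d : ℕ} (hd : 0 < d) (ε : ℝ) :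
    (d : ℝ) ^ (1 - ε) * (d : ℝ) ^ (1 + ε) = (d : ℝ) ^ 2 := by
  rw [← Real.rpow_add (by exact_mod_cast hd), ← Real.rpow_natCast]
  norm_num

theorem signVector_dotProduct_self {d : ℕ} (b : Fin d → Bool) :
    signVector b ⬝ᵥ signVector b = d := by
  have : ∀ j, signVector b j * signVector b j = 1 := fun j => by
    simp only [signVector]; split_ifs <;> norm_num
  simp [dotProduct, this]

/-! ### Random sign vectors -/

theorem sum_comp_eval {ι A : Type*} [Fintype ι] [DecidableEq ι] [Fintype A] [Nonempty A]
    (i : ι) (F : A → ℝ) :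
    ∑ b : ι → A, F (b i)
      = (Fintype.card A : ℝ) ^ Fintype.card ι * ((∑ a, F a) / Fintype.card A) := by
  have hA : (Fintype.card A : ℝ) ≠ 0 := by simp
  have h := Finset.prod_univ_sum (fun _ : ι => (Finset.univ : Finset A))
    (fun k a => if k = i then F a else (1 : ℝ))
  simp only [Finset.prod_ite_eq', Finset.mem_univ, if_true, Fintype.piFinset_univ] at h
  rw [← h]
  -- A factor `|A|` is pulled out at every index, including `i`; this avoids the exponent `|ι| - 1`.
  have : ∀ k, (∑ a : A, if k = i then F a else (1 : ℝ))
      = Fintype.card A * (if k = i then (∑ a, F a) / Fintype.card A else 1) := fun k => by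
    split_ifs
    · field_simp
    · simp
  rw [Finset.prod_congr rfl fun k _ => this k, Finset.prod_mul_distrib]
  simp

theorem sum_exp_signVector {d : ℕ} (s : ℝ) :
    ∑ c : Fin d → Bool, Real.exp (s * ∑ l, signVector c l) = (2 * Real.cosh s) ^ d := by
  have h := Finset.prod_univ_sum (fun _ : Fin d => (Finset.univ : Finset Bool))
    (fun _ a => Real.exp (s * if a then 1 else -1))
  simp only [Fintype.piFinset_univ] at h
  have e : ∀ c : Fin d → Bool, Real.exp (s * ∑ l, signVector c l)
      = ∏ l, Real.exp (s * if c l then 1 else -1) := fun c => by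
    rw [Finset.mul_sum, Real.exp_sum]; rfl
  simp only [e, ← h]
  simp [Real.cosh_eq]
  ring

/-- Multiplying the `i`-th sign vector entrywise by the `j`-th is an involution of the sample space.
It turns the inner product into a sum of `d` independent signs, whose exponential moment factorizes.
-/
theorem sum_exp_dotProduct {d N : ℕ} {i j : Fin N} (hij : i ≠ j) (s : ℝ) :
    ∑ b : Fin N → Fin d → Bool, Real.exp (s * (signVector (b i) ⬝ᵥ signVector (b j)))
      = (2 ^ d) ^ N * Real.cosh s ^ d := by
  have hinv : Function.Involutive fun b : Fin N → Fin d → Bool =>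
      Function.update b i fun l => b i l == b j l := by
    intro b
    funext k
    by_cases hk : k = i
    · subst hk
      funext l
      simp only [Function.update_self, Function.update_of_ne hij.symm]
      cases b k l <;> cases b j l <;> rfl
    · simp [hk]
  have hdot : ∀ b : Fin N → Fin d → Bool, signVector (b i) ⬝ᵥ signVector (b j)
      = ∑ l, signVector (hinv.toPerm _ b i) l := fun b => by
    refine Finset.sum_congr rfl fun l _ => ?_
    simp only [Function.Involutive.coe_toPerm, Function.update_self, signVector]
    cases b i l <;> cases b j l <;> simp
  simp only [hdot]
  rw [Equiv.sum_comp (hinv.toPerm _) (fun b : Fin N → Fin d → Bool =>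
    Real.exp (s * ∑ l, signVector (b i) l)),
    sum_comp_eval i fun c : Fin d → Bool => Real.exp (s * ∑ l, signVector c l),
    sum_exp_signVector]
  simp [mul_pow]

/-- Chernoff bound for both tails, using `cosh s ≤ exp (s² / 2)`. -/
theorem card_sq_dotProduct_ge_le {d N : ℕ} (hd : 0 < d) {i j : Fin N} (hij : i ≠ j) {τ : ℝ}
    (hτ : 0 ≤ τ) :
    ((Finset.univ.filter fun b : Fin N → Fin d → Bool =>
      τ ≤ (signVector (b i) ⬝ᵥ signVector (b j)) ^ 2).card : ℝ)
      ≤ 2 * (2 ^ d) ^ N * Real.exp (-(τ / (2 * d))) := by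
  have hd0 : (0 : ℝ) < d := by exact_mod_cast hd
  set X : (Fin N → Fin d → Bool) → ℝ := fun b => signVector (b i) ⬝ᵥ signVector (b j) with hX
  -- This `s` minimizes the exponent `d s² / 2 - s √τ`, with value `-τ / (2 d)`.
  set s := √τ / d with hs
  have hs0 : 0 ≤ s := by positivity
  have hpt : ∀ b, (if τ ≤ X b ^ 2 then Real.exp (τ / d) else 0)
      ≤ Real.exp (s * X b) + Real.exp (-s * X b) := fun b => by
    split_ifs with hb
    · have habs : √τ ≤ |X b| := Real.sqrt_le_sqrt hb |>.trans_eq (Real.sqrt_sq_eq_abs _)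
      have e : τ / d = s * √τ := by rw [hs, div_mul_eq_mul_div, Real.mul_self_sqrt hτ]
      have h1 : Real.exp (τ / d) ≤ Real.exp (s * |X b|) := by rw [e]; gcongr
      rcases abs_cases (X b) with ⟨h2, _⟩ | ⟨h2, _⟩
      · rw [h2] at h1
        linarith [Real.exp_pos (-s * X b)]
      · rw [h2, mul_neg, ← neg_mul] at h1
        linarith [Real.exp_pos (s * X b)]
    · positivity
  have hsum := Finset.sum_le_sum fun b (_ : b ∈ Finset.univ) => hpt b
  rw [Finset.sum_add_distrib, sum_exp_dotProduct hij, sum_exp_dotProduct hij, Real.cosh_neg,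
    ← Finset.sum_filter, Finset.sum_const, nsmul_eq_mul] at hsum
  have hcosh : Real.cosh s ^ d ≤ Real.exp (τ / (2 * d)) := by
    refine (pow_le_pow_left₀ (Real.cosh_pos s).le (Real.cosh_le_exp_half_sq s) d).trans_eq ?_
    rw [← Real.exp_nat_mul, hs, div_pow, Real.sq_sqrt hτ]
    congr 1
    field_simp
  have hexp : Real.exp (τ / d) = Real.exp (τ / (2 * d)) * Real.exp (τ / (2 * d)) := by
    rw [← Real.exp_add]; congr 1; field_simp; ring
  rw [Real.exp_neg, ← div_eq_mul_inv, le_div_iff₀ (Real.exp_pos _)]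
  refine le_of_mul_le_mul_right ?_ (Real.exp_pos (τ / (2 * d)))
  rw [mul_assoc, ← hexp]
  refine hsum.trans ?_
  have : (0 : ℝ) ≤ (2 ^ d) ^ N := by positivity
  nlinarith

/-- Independent random sign vectors are likely to be nearly orthogonal. -/
theorem half_le_card_nearly_orthogonal {d N : ℕ} (hd : 0 < d) {ε : ℝ}
    (hN : (N : ℝ) ≤ Real.exp ((d : ℝ) ^ ε / 8) / 2) :
    (2 ^ d : ℝ) ^ N / 2 ≤ ((Finset.univ.filter fun b : Fin N → Fin d → Bool =>
      ∀ i j, i ≠ j → (signVector (b i) ⬝ᵥ signVector (b j)) ^ 2 < (d : ℝ) ^ (1 + ε)).card : ℝ) := by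
  have hd0 : (0 : ℝ) < d := by exact_mod_cast hd
  set τ := (d : ℝ) ^ (1 + ε) with hτ
  set y := (d : ℝ) ^ ε with hy
  have hτy : τ = d * y := by rw [hτ, Real.rpow_add hd0, Real.rpow_one]
  have hy0 : 0 < y := Real.rpow_pos_of_pos hd0 _
  set G := Finset.univ.filter fun b : Fin N → Fin d → Bool =>
      ∀ i j, i ≠ j → (signVector (b i) ⬝ᵥ signVector (b j)) ^ 2 < τ with hG
  let E : Fin N × Fin N → Finset (Fin N → Fin d → Bool) := fun p =>
    if p.1 = p.2 then ∅ else
      Finset.univ.filter fun b => τ ≤ (signVector (b p.1) ⬝ᵥ signVector (b p.2)) ^ 2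
  have hcover : (Finset.univ : Finset (Fin N → Fin d → Bool))
      ⊆ G ∪ Finset.univ.biUnion E := by
    intro b _
    by_cases hb : b ∈ G
    · exact Finset.mem_union_left _ hb
    · refine Finset.mem_union_right _ ?_
      simp only [hG, Finset.mem_filter, Finset.mem_univ, true_and, not_forall, not_lt] at hb
      obtain ⟨i, j, hij, hle⟩ := hb
      refine Finset.mem_biUnion.2 ⟨(i, j), Finset.mem_univ _, ?_⟩
      simp only [E, if_neg hij, Finset.mem_filter, Finset.mem_univ, true_and]
      exact hle
  have hE : ∀ p, ((E p).card : ℝ) ≤ 2 * (2 ^ d) ^ N * Real.exp (-(y / 2)) := fun p => by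
    by_cases hp : p.1 = p.2
    · simp only [E, if_pos hp, Finset.card_empty, Nat.cast_zero]; positivity
    · have h1 := card_sq_dotProduct_ge_le hd hp (τ := τ) (by rw [hτy]; positivity)
      have e : τ / (2 * d) = y / 2 := by rw [hτy]; field_simp
      rw [e] at h1
      simpa only [E, if_neg hp] using h1
  have hcard : ((2 : ℝ) ^ d) ^ N ≤ G.card + ∑ p, ((E p).card : ℝ) := by
    have h1 := (Finset.card_le_card hcover).trans (Finset.card_union_le _ _)
    have h2 := Finset.card_biUnion_le (s := Finset.univ) (t := E)
    have h3 := h1.trans (Nat.add_le_add_left h2 _)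
    simp only [Finset.card_univ, Fintype.card_pi, Finset.prod_const, Fintype.card_bool,
      Fintype.card_fin] at h3
    exact_mod_cast h3
  have hsum : ∑ p, ((E p).card : ℝ) ≤ N ^ 2 * (2 * (2 ^ d) ^ N * Real.exp (-(y / 2))) := by
    have := Finset.sum_le_sum fun p (_ : p ∈ Finset.univ) => hE p
    simpa [sq] using this
  -- Union bound over `N²` ordered pairs: each fails with probability at most `2 exp (-y / 2)`, so
  -- the total is at most `2 · 1/4 = 1/2`.
  have hN2 : (N : ℝ) ^ 2 * Real.exp (-(y / 2)) ≤ 1 / 4 := by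
    have h1 : (N : ℝ) ^ 2 ≤ Real.exp (y / 4) / 4 := by
      refine (pow_le_pow_left₀ (Nat.cast_nonneg N) hN 2).trans_eq ?_
      rw [div_pow, ← Real.exp_nat_mul]
      norm_num
      ring_nf
    calc (N : ℝ) ^ 2 * Real.exp (-(y / 2)) ≤ Real.exp (y / 4) / 4 * Real.exp (-(y / 2)) := by gcongr
      _ = Real.exp (-(y / 4)) / 4 := by
        rw [div_mul_eq_mul_div, ← Real.exp_add]; ring_nf
      _ ≤ 1 / 4 := by
        have : Real.exp (-(y / 4)) ≤ 1 := Real.exp_le_one_iff.2 (by linarith)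
        linarith
  have hpos : (0 : ℝ) ≤ (2 ^ d) ^ N := by positivity
  nlinarith

/-- Two equal vectors of the family would have squared inner product `d²`, which is at least
`d^(1+ε)` because `ε ≤ 1`. -/
theorem signVector_family_spec {d N : ℕ} (hd : 2 ≤ d) {ε : ℝ} (hε1 : ε ≤ 1)
    {b : Fin N → Fin d → Bool}
    (hb : ∀ i j, i ≠ j → (signVector (b i) ⬝ᵥ signVector (b j)) ^ 2 < (d : ℝ) ^ (1 + ε)) :
    Function.Injective (fun i => signVector (b i)) ∧ ∀ U : Finset (Fin d → ℝ),
      IsSpectralSpanner ((d : ℝ) ^ (1 - ε)) (Finset.univ.image fun i => signVector (b i)) U →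
        U = Finset.univ.image fun i => signVector (b i) := by
  have hd0 : (0 : ℝ) < d := by exact_mod_cast (show 0 < d by omega)
  have hd1 : (1 : ℝ) ≤ d := by exact_mod_cast (show 1 ≤ d by omega)
  constructor
  · intro i j hij
    by_contra hne
    have h1 := hb i j hne
    simp only at hij
    rw [hij, signVector_dotProduct_self] at h1
    have h2 : (d : ℝ) ^ (1 + ε) ≤ (d : ℝ) ^ (2 : ℝ) :=
      Real.rpow_le_rpow_of_exponent_le hd1 (by linarith)
    rw [Real.rpow_two] at h2
    linarith
  · intro U hU
    refine hU.eq_of_nearly_orthogonal (β := (d : ℝ) ^ (1 + ε)) (q := d)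
      (Real.rpow_pos_of_pos hd0 _) ?_ (rpow_one_sub_mul_rpow_one_add (by omega) ε).le ?_
    · intro v hv
      obtain ⟨i, -, rfl⟩ := Finset.mem_image.1 hv
      exact signVector_dotProduct_self _
    · intro v hv u hu huv
      obtain ⟨i, -, rfl⟩ := Finset.mem_image.1 hv
      obtain ⟨j, -, rfl⟩ := Finset.mem_image.1 hu
      exact hb j i fun e => huv (by rw [e])

theorem half_le_measure_spanner_eq {d : ℕ} (hd : 2 ≤ d) {ε : ℝ} (hε1 : ε ≤ 1) {N : ℕ}
    (hN : (N : ℝ) ≤ Real.exp ((d : ℝ) ^ ε / 8) / 2) :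
    1 / 2 ≤ (PMF.uniformOfFintype (Fin N → Fin d → Bool)).toMeasure
      {b | Function.Injective (fun i => signVector (b i)) ∧
        ∀ U : Finset (Fin d → ℝ),
          IsSpectralSpanner ((d : ℝ) ^ (1 - ε))
            (Finset.univ.image fun i => signVector (b i)) U →
          U = Finset.univ.image fun i => signVector (b i)} := by
  classical
  have h := half_le_card_nearly_orthogonal (by omega) hN
  set G := Finset.univ.filter fun b : Fin N → Fin d → Bool =>
      ∀ i j, i ≠ j → (signVector (b i) ⬝ᵥ signVector (b j)) ^ 2 < (d : ℝ) ^ (1 + ε) with hG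
  refine le_trans ?_ (MeasureTheory.measure_mono (s := (G : Set (Fin N → Fin d → Bool)))
    fun b hb => signVector_family_spec hd hε1 (by simpa [hG] using hb))
  have hm : MeasurableSet (G : Set (Fin N → Fin d → Bool)) := .of_discrete
  rw [PMF.toMeasure_uniformOfFintype_apply _ hm]
  have hGc : Fintype.card (G : Set (Fin N → Fin d → Bool)) = G.card := by simp
  have hcard : Fintype.card (Fin N → Fin d → Bool) = (2 ^ d) ^ N := by simp
  rw [hcard]
  have hG' : ((2 ^ d) ^ N : ℕ) ≤ 2 * G.card := by
    have : ((2 : ℝ) ^ d) ^ N ≤ 2 * G.card := by linarith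
    exact_mod_cast this
  rw [ENNReal.le_div_iff_mul_le (by simp) (by simp), hGc, mul_comm, mul_one_div]
  refine ENNReal.div_le_of_le_mul ?_
  rw [mul_comm]
  exact_mod_cast hG'

theorem exists_signVectors_spanner_eq {d : ℕ} (hd : 2 ≤ d) {ε : ℝ} (hε1 : ε ≤ 1) {N : ℕ}
    (hN : (N : ℝ) ≤ Real.exp ((d : ℝ) ^ ε / 8) / 2) :
    ∃ V : Finset (Fin d → ℝ), V.card = N ∧ (∀ v ∈ V, ∀ j, v j = 1 ∨ v j = -1) ∧
      ∀ U : Finset (Fin d → ℝ), IsSpectralSpanner ((d : ℝ) ^ (1 - ε)) V U → U = V := by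
  have h := half_le_card_nearly_orthogonal (by omega) hN
  obtain ⟨b, hb⟩ := Finset.card_pos.1 (show 0 < _ by
    exact_mod_cast lt_of_lt_of_le (show (0 : ℝ) < (2 ^ d) ^ N / 2 by positivity) h)
  obtain ⟨hinj, hU⟩ := signVector_family_spec hd hε1 (Finset.mem_filter.1 hb).2
  refine ⟨_, ?_, ?_, hU⟩
  · rw [Finset.card_image_of_injective _ hinj, Finset.card_univ, Fintype.card_fin]
  · intro v hv j
    obtain ⟨i, -, rfl⟩ := Finset.mem_image.1 hv
    simp only [signVector]
    split_ifs <;> simp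

/-! ### Lower-bound sets for every positive exponent. -/

theorem exists_pair_spanner_eq {d : ℕ} (hd : 2 ≤ d) {ε : ℝ} (hε : 0 < ε) :
    ∃ V : Finset (Fin d → ℝ), V.card = 2 ∧ (∀ v ∈ V, ∀ j, v j = 1 ∨ v j = -1) ∧
      ∀ U : Finset (Fin d → ℝ), IsSpectralSpanner ((d : ℝ) ^ (1 - ε)) V U → U = V := by
  have hd0 : (0 : ℝ) < d := by exact_mod_cast (show 0 < d by omega)
  have hd1 : (1 : ℝ) < d := by exact_mod_cast (show 1 < d by omega)
  set a : Fin d → ℝ := fun _ => 1 with ha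
  -- The all-ones and the alternating vector have inner product 0 or 1, by the parity of `d`, and `1
  -- < d^(1+ε)`.
  set b : Fin d → ℝ := fun j => (-1) ^ (j : ℕ) with hb
  have hbj : ∀ j, b j = 1 ∨ b j = -1 := fun j => neg_one_pow_eq_or ℝ _
  have hne : a ≠ b := fun e => by
    have := congrFun e ⟨1, by omega⟩
    simp [ha, hb] at this
    norm_num at this
  have hab : (a ⬝ᵥ b) ^ 2 < (d : ℝ) ^ (1 + ε) := by
    have h1 : a ⬝ᵥ b = if Even d then 0 else 1 := by
      simp only [ha, hb, dotProduct, one_mul]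
      rw [Fin.sum_univ_eq_sum_range fun j => (-1 : ℝ) ^ j, neg_one_geom_sum]
    have h2 : (a ⬝ᵥ b) ^ 2 ≤ 1 := by rw [h1]; split_ifs <;> norm_num
    exact h2.trans_lt (Real.one_lt_rpow hd1 (by linarith))
  have haa : a ⬝ᵥ a = d := by simp [ha, dotProduct]
  have hbb : b ⬝ᵥ b = d := by
    have : ∀ j, b j * b j = 1 := fun j => by rcases hbj j with h | h <;> rw [h] <;> norm_num
    simp [dotProduct, this]
  refine ⟨{a, b}, Finset.card_pair hne, ?_, fun U hU => ?_⟩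
  · intro v hv j
    rcases Finset.mem_insert.1 hv with rfl | hv
    · exact Or.inl rfl
    · rw [Finset.mem_singleton.1 hv]; exact hbj j
  · refine hU.eq_of_nearly_orthogonal (β := (d : ℝ) ^ (1 + ε)) (q := d)
      (Real.rpow_pos_of_pos hd0 _) ?_ (rpow_one_sub_mul_rpow_one_add (by omega) ε).le ?_
    · simp [haa, hbb]
    · intro v hv u hu huv
      simp only [Finset.mem_insert, Finset.mem_singleton] at hv hu
      rcases hv with rfl | rfl <;> rcases hu with rfl | rfl
      · exact absurd rfl huv
      · rwa [dotProduct_comm]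
      · exact hab
      · exact absurd rfl huv

/-- For `α < 1` only sets without nonzero vectors have an `α`-spectral spanner. -/
theorem not_isSpectralSpanner_of_lt_one {d : ℕ} {α : ℝ} (hα0 : 0 ≤ α) (hα : α < 1)
    {V U : Finset (Fin d → ℝ)} {v₀ : Fin d → ℝ} (hv₀ : v₀ ∈ V) (hne : v₀ ≠ 0) :
    ¬ IsSpectralSpanner α V U := by
  intro h
  obtain ⟨hUV, hspan⟩ := isSpectralSpanner_iff.1 h
  -- For the vector extreme in the direction `v₀`, the spanner inequality at `v₀` would give `⟨v,
  -- v₀⟩² ≤ α ⟨v, v₀⟩²`.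
  obtain ⟨v, hv, hmax⟩ := V.exists_max_image (fun v => (v ⬝ᵥ v₀) ^ 2) ⟨v₀, hv₀⟩
  have hpos : 0 < (v ⬝ᵥ v₀) ^ 2 := by
    refine lt_of_lt_of_le ?_ (hmax v₀ hv₀)
    have : v₀ ⬝ᵥ v₀ ≠ 0 := fun e => hne (dotProduct_self_eq_zero.1 e)
    positivity
  obtain ⟨μ, hμ0, hμ1, hμ⟩ := hspan v hv
  have hsum : ∑ u ∈ U, μ u * (u ⬝ᵥ v₀) ^ 2 ≤ ∑ u ∈ U, μ u * (v ⬝ᵥ v₀) ^ 2 :=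
    Finset.sum_le_sum fun u hu => mul_le_mul_of_nonneg_left (hmax u (hUV hu)) (hμ0 u hu)
  rw [← Finset.sum_mul, hμ1, one_mul] at hsum
  have := hμ v₀
  nlinarith

/-- Three regimes. For `ε ≤ 1` and `d^ε ≤ 32` a pair is enough, as `32/50 < log 2`. For `ε ≤ 1` and
larger `d^ε` random sign vectors serve, since `exp (y/8) / 2 ≥ 2 exp (y/50)` absorbs the rounding.
For `ε > 1` the parameter is below 1, no spanner exists once a nonzero vector is present, and the
claim is vacuous for arbitrarily large sets. -/
theorem exists_large_spanner_eq {d : ℕ} (hd : 2 ≤ d) {ε : ℝ} (hε : 0 < ε) :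
    ∃ V : Finset (Fin d → ℝ), Real.exp (1 / 50 * (d : ℝ) ^ ε) ≤ (V.card : ℝ) ∧
      (ε ≤ 1 → ∀ v ∈ V, ∀ j, v j = 1 ∨ v j = -1) ∧
      ∀ U : Finset (Fin d → ℝ), IsSpectralSpanner ((d : ℝ) ^ (1 - ε)) V U → U = V := by
  have hd1 : (1 : ℝ) < d := by exact_mod_cast (show 1 < d by omega)
  set y := (d : ℝ) ^ ε with hy
  rcases le_or_gt ε 1 with hε1 | hε1
  · rcases le_or_gt y 32 with hy32 | hy32
    · obtain ⟨V, hV, hpm, hU⟩ := exists_pair_spanner_eq hd hε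
      refine ⟨V, ?_, fun _ => hpm, hU⟩
      rw [hV, ← Real.le_log_iff_exp_le (by norm_num)]
      have := Real.log_two_gt_d9
      push_cast
      linarith
    · obtain ⟨V, hV, hpm, hU⟩ := exists_signVectors_spanner_eq hd hε1 (Nat.floor_le
        (show 0 ≤ Real.exp ((d : ℝ) ^ ε / 8) / 2 by positivity))
      refine ⟨V, ?_, fun _ => hpm, hU⟩
      rw [hV, ← hy]
      have h1 := Nat.lt_floor_add_one (Real.exp (y / 8) / 2)
      have h2 : Real.exp (y / 8) = Real.exp (1 / 50 * y) * Real.exp (21 / 200 * y) := by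
        rw [← Real.exp_add]; congr 1; ring
      have h3 : 4 ≤ Real.exp (21 / 200 * y) := by
        have := Real.add_one_le_exp (21 / 200 * y)
        linarith
      have h4 : 1 ≤ Real.exp (1 / 50 * y) := Real.one_le_exp (by linarith)
      nlinarith
  · obtain ⟨N, hN⟩ := exists_nat_ge (Real.exp (1 / 50 * y))
    have hinj : Function.Injective fun k : ℕ => (fun _ => (k : ℝ) + 1 : Fin d → ℝ) := by
      intro k l hkl
      have := congrFun hkl ⟨0, by omega⟩
      simpa using this
    have hN0 : 0 < N := by
      have := (Real.exp_pos (1 / 50 * y)).trans_le hN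
      exact_mod_cast this
    refine ⟨(Finset.range N).image fun k : ℕ => (fun _ => (k : ℝ) + 1 : Fin d → ℝ), ?_,
      fun h => absurd h (not_le.2 hε1), fun U hU => ?_⟩
    · rwa [Finset.card_image_of_injective _ hinj, Finset.card_range]
    · refine absurd hU (not_isSpectralSpanner_of_lt_one (Real.rpow_nonneg (by linarith) _)
        (Real.rpow_lt_one_of_one_lt_of_neg hd1 (by linarith))
        (Finset.mem_image_of_mem _ (Finset.mem_range.2 hN0)) fun e => ?_)
      have := congrFun e ⟨0, by omega⟩
      simp at this

/-! ### Refinement of a spanner -/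

/-- Every vector of the family `v` lies in the ellipsoid of twice the Gram form of `W`. -/
def Covers {d n : ℕ} (v : Fin n → Fin d → ℝ) (W : Finset (Fin n)) : Prop :=
  ∀ i y, (v i ⬝ᵥ y) ^ 2 ≤ 2 * ∑ k ∈ W, (v k ⬝ᵥ y) ^ 2

/-- `U` arises from `W` by one pass through the family `v` that keeps the vectors which stick out of
the ellipsoid of the scaled Gram form of `W` plus that of the vectors kept before. -/
def Refines {d n : ℕ} (v : Fin n → Fin d → ℝ) (W U : Finset (Fin n)) : Prop :=
  ∀ i, i ∉ U ↔ ∀ y, (v i ⬝ᵥ y) ^ 2 ≤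
    (2 * (W.card : ℝ))⁻¹ * ∑ k ∈ W, (v k ⬝ᵥ y) ^ 2 + ∑ j ∈ U with j < i, (v j ⬝ᵥ y) ^ 2

/-- Every vector, kept or not, satisfies `⟨v i, y⟩² ≤ T / (2m) + Q` with `m = |W|`. Summing over `W`
gives `T ≤ T / 2 + m Q`, that is `T / (2m) ≤ Q`, and hence the bound `2 Q`. -/
theorem Refines.covers {d n : ℕ} {v : Fin n → Fin d → ℝ} {W U : Finset (Fin n)}
    (h : Refines v W U) (hW : Covers v W) : Covers v U := by
  intro i y
  set T := ∑ k ∈ W, (v k ⬝ᵥ y) ^ 2 with hT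
  set Q := ∑ k ∈ U, (v k ⬝ᵥ y) ^ 2 with hQ
  have hT0 : 0 ≤ T := by positivity
  have hQ0 : 0 ≤ Q := by positivity
  rcases W.eq_empty_or_nonempty with rfl | hne
  · have := hW i y
    simp only [Finset.sum_empty, mul_zero] at this
    linarith
  · have hm : (0 : ℝ) < W.card := by exact_mod_cast hne.card_pos
    have hall : ∀ i, (v i ⬝ᵥ y) ^ 2 ≤ (2 * (W.card : ℝ))⁻¹ * T + Q := fun i => by
      by_cases hi : i ∈ U
      · have h1 : (v i ⬝ᵥ y) ^ 2 ≤ Q :=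
          Finset.single_le_sum (f := fun k => (v k ⬝ᵥ y) ^ 2) (fun _ _ => sq_nonneg _) hi
        have h2 : 0 ≤ (2 * (W.card : ℝ))⁻¹ * T := by positivity
        linarith
      · refine ((h i).1 hi y).trans (add_le_add_right ?_ _)
        exact Finset.sum_le_sum_of_subset_of_nonneg (Finset.filter_subset _ _)
          fun _ _ _ => sq_nonneg _
    have hsum : T ≤ W.card * ((2 * (W.card : ℝ))⁻¹ * T + Q) := by
      have := Finset.sum_le_card_nsmul W _ _ fun k _ => hall k
      rwa [nsmul_eq_mul] at this
    have e : W.card * ((2 * (W.card : ℝ))⁻¹ * T + Q) = T / 2 + W.card * Q := by field_simp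
    have h3 : (2 * (W.card : ℝ))⁻¹ * T ≤ Q := by
      rw [inv_mul_le_iff₀ (by positivity)]
      linarith
    linarith [hall i]

/-- The determinant potential with the Gram form of `W` as base, `δ = 1 / (2|W|)`, and `K = 2` from
the covering property. -/
theorem Refines.two_pow_card_le {d n : ℕ} (hd : 0 < d) {v : Fin n → Fin d → ℝ}
    {W U : Finset (Fin n)} (h : Refines v W U) (hW : Covers v W) :
    (2 : ℝ) ^ U.card ≤ (1 + 4 * U.card * W.card / d) ^ d := by
  have hex : ∀ i : Fin n, ∃ y, i ∈ U → (2 * (W.card : ℝ))⁻¹ * ∑ k ∈ W, (v k ⬝ᵥ y) ^ 2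
      + ∑ j ∈ U with j < i, (v j ⬝ᵥ y) ^ 2 < (v i ⬝ᵥ y) ^ 2 := fun i => by
    by_cases hi : i ∈ U
    · have := (not_congr (h i)).1 (not_not.2 hi)
      push Not at this
      obtain ⟨y, hy⟩ := this
      exact ⟨y, fun _ => hy⟩
    · exact ⟨0, fun h => absurd h hi⟩
  choose y hy using hex
  rcases W.eq_empty_or_nonempty with rfl | hne
  · have hU : U = ∅ := by
      refine Finset.eq_empty_of_forall_notMem fun i hi => ?_
      have h1 := hy i hi
      have h2 := hW i (y i)
      simp only [Finset.sum_empty, mul_zero, zero_add] at h1 h2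
      have h3 : 0 ≤ ∑ j ∈ U with j < i, (v j ⬝ᵥ y i) ^ 2 := by positivity
      linarith
    simp [hU]
  · have hm : (0 : ℝ) < W.card := by exact_mod_cast hne.card_pos
    have key := _root_.two_pow_card_le hd (δ := (2 * (W.card : ℝ))⁻¹) (K := 2) (by positivity)
      (by norm_num) v W v y U (fun i _ => hW i) hy
    refine key.trans_eq ?_
    congr 2
    field_simp
    ring

/-- If the pass does not shrink the family, `|W| ≤ |U|` turns the potential bound into the
hypothesis of `le_of_two_pow_le`. -/
theorem Refines.card_le_or_lt {d n : ℕ} (hd : 2 ≤ d) {v : Fin n → Fin d → ℝ}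
    {W U : Finset (Fin n)} (h : Refines v W U) (hW : Covers v W) :
    (U.card : ℝ) ≤ 30 * (d * Real.log d) ∨ U.card < W.card := by
  by_contra! hcon
  refine absurd (le_of_two_pow_le hd ((h.two_pow_card_le (by omega) hW).trans ?_))
    (not_le.2 hcon.1)
  have : (W.card : ℝ) ≤ U.card := by exact_mod_cast hcon.2
  refine pow_le_pow_left₀ (by positivity) ?_ d
  have : 4 * (U.card : ℝ) * W.card ≤ 4 * (U.card : ℝ) ^ 2 := by
    rw [sq, ← mul_assoc]; gcongr
  gcongr

theorem Covers.mono {d n : ℕ} {v : Fin n → Fin d → ℝ} {W U : Finset (Fin n)}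
    (hW : Covers v W) (h : W ⊆ U) : Covers v U := fun i y =>
  (hW i y).trans (mul_le_mul_of_nonneg_left
    (Finset.sum_le_sum_of_subset_of_nonneg h fun _ _ _ => sq_nonneg _) zero_le_two)

/-- A covering subfamily is a spectral spanner, with the uniform distribution. -/
theorem Covers.isSpectralSpanner {d n : ℕ} {v : Fin n ↪ (Fin d → ℝ)} {W : Finset (Fin n)}
    (h : Covers v W) (hW : 0 < n → W.Nonempty) {α : ℝ} (hα : 2 * W.card ≤ α) :
    IsSpectralSpanner α (Finset.univ.map v) (W.map v) := by
  refine isSpectralSpanner_iff.2 ⟨Finset.map_subset_map.2 (Finset.subset_univ _), fun w hw => ?_⟩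
  obtain ⟨i, -, rfl⟩ := Finset.mem_map.1 hw
  have hm : (0 : ℝ) < W.card := by exact_mod_cast (hW i.pos).card_pos
  refine ⟨fun _ => (W.card : ℝ)⁻¹, fun _ _ => by positivity, ?_, fun x => ?_⟩
  · simp [hm.ne']
  · rw [Finset.sum_map, ← Finset.mul_sum, ← mul_assoc]
    refine (h i x).trans (mul_le_mul_of_nonneg_right ?_ (by positivity))
    rwa [← div_eq_mul_inv, le_div_iff₀ hm]

/-! ### Symmetric elimination -/

theorem dotProduct_single_mulVec {ι : Type*} [Fintype ι] [DecidableEq ι] (i : ι) (r : ℝ)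
    (z : ι → ℝ) : z ⬝ᵥ (Matrix.single i i r *ᵥ z) = r * z i ^ 2 := by
  have e : Matrix.single i i r *ᵥ z = Pi.single i (r * z i) := single_mulVec _ _ _ _
  rw [e, dotProduct_single]
  ring

/-- One step of symmetric Gaussian elimination; a zero pivot leaves the matrix unchanged. -/
noncomputable def elimStep {ι : Type*} (N : Matrix ι ι ℝ) (l : ι) : Matrix ι ι ℝ :=
  fun a b => N a b - N a l * N l b / N l l

theorem elimStep_transpose {ι : Type*} {N : Matrix ι ι ℝ} (hN : Nᵀ = N) (l : ι) :
    (elimStep N l)ᵀ = elimStep N l := by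
  have h : ∀ a b, N a b = N b a := fun a b => by conv_lhs => rw [← hN, transpose_apply]
  ext a b
  simp only [transpose_apply, elimStep]
  rw [h b a, h b l, h l a, mul_comm]

/-- Elimination completes a square: for a nonzero pivot it removes from the form the square of the
linear form of row `l`. -/
theorem dotProduct_elimStep_mulVec {ι : Type*} [Fintype ι] {N : Matrix ι ι ℝ} (hN : Nᵀ = N)
    (l : ι) (x : ι → ℝ) :
    x ⬝ᵥ (elimStep N l *ᵥ x) = x ⬝ᵥ (N *ᵥ x) - (N l ⬝ᵥ x) ^ 2 / N l l := by
  have h : ∀ a b, N a b = N b a := fun a b => by conv_lhs => rw [← hN, transpose_apply]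
  have e : elimStep N l = N - (N l l)⁻¹ • vecMulVec (N l) (N l) := by
    ext a b
    simp only [elimStep, Matrix.sub_apply, Matrix.smul_apply, vecMulVec_apply, smul_eq_mul, h a l]
    ring
  rw [e, sub_mulVec, smul_mulVec, dotProduct_sub, dotProduct_smul, dotProduct_vecMulVec_mulVec,
    smul_eq_mul]
  ring

theorem posSemidef_of_transpose_eq {ι : Type*} [Fintype ι] {N : Matrix ι ι ℝ} (hN : Nᵀ = N)
    (h : ∀ x, 0 ≤ x ⬝ᵥ (N *ᵥ x)) : N.PosSemidef :=
  .of_dotProduct_mulVec_nonneg (by rw [IsHermitian, conjTranspose_eq_transpose_of_trivial, hN])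
    (by simpa using h)

theorem Matrix.PosSemidef.transpose_eq {ι : Type*} {N : Matrix ι ι ℝ}
    (hN : N.PosSemidef) : Nᵀ = N := by
  simpa using hN.1.eq

theorem dotProduct_mulVec_sub_single {ι : Type*} [Fintype ι] [DecidableEq ι] {N : Matrix ι ι ℝ}
    (hN : Nᵀ = N) (l : ι) (x : ι → ℝ) (c : ℝ) :
    (x - c • Pi.single l 1) ⬝ᵥ (N *ᵥ (x - c • Pi.single l 1))
      = x ⬝ᵥ (N *ᵥ x) - 2 * c * (N l ⬝ᵥ x) + c ^ 2 * N l l := by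
  have h1 : x ⬝ᵥ (N *ᵥ Pi.single l 1) = N l ⬝ᵥ x := by
    rw [dotProduct_mulVec, ← mulVec_transpose, hN, dotProduct_single_one]
    rfl
  have h2 : Pi.single l 1 ⬝ᵥ (N *ᵥ x) = N l ⬝ᵥ x := by rw [single_one_dotProduct]; rfl
  have h3 : Pi.single l 1 ⬝ᵥ (N *ᵥ Pi.single l 1) = N l l := by
    rw [single_one_dotProduct, mulVec_single_one]; rfl
  simp only [mulVec_sub, mulVec_smul, sub_dotProduct, dotProduct_sub, smul_dotProduct,
    dotProduct_smul, smul_eq_mul, h1, h2, h3]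
  ring

/-- The eliminated form at `x` is the original form at `x` shifted along the `l`-th axis to the
minimizing point. For a zero pivot, division by zero makes the shift vanish. -/
theorem Matrix.PosSemidef.elimStep {ι : Type*} [Fintype ι] [DecidableEq ι] {N : Matrix ι ι ℝ}
    (hN : N.PosSemidef) (l : ι) : (elimStep N l).PosSemidef := by
  refine posSemidef_of_transpose_eq (elimStep_transpose hN.transpose_eq l) fun x => ?_
  have h := hN.dotProduct_mulVec_nonneg (x - ((N l ⬝ᵥ x) / N l l) • Pi.single l 1)
  rw [star_trivial, dotProduct_mulVec_sub_single hN.transpose_eq] at h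
  rw [dotProduct_elimStep_mulVec hN.transpose_eq]
  refine h.trans_eq ?_
  by_cases h0 : N l l = 0
  · simp [h0]
  · field_simp
    ring

/-- This makes zero pivots harmless: their rows are already eliminated. -/
theorem Matrix.PosSemidef.apply_eq_zero_of_diag {ι : Type*} [Fintype ι] [DecidableEq ι]
    {N : Matrix ι ι ℝ} (hN : N.PosSemidef) {l : ι} (h0 : N l l = 0) (b : ι) : N l b = 0 := by
  have h := hN.dotProduct_mulVec_zero_iff (Pi.single l 1)
  rw [star_trivial, single_one_dotProduct, mulVec_single_one] at h
  have h1 := congrFun (h.1 h0) b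
  have h2 := congrFun (congrFun hN.transpose_eq b) l
  rw [transpose_apply] at h2
  rw [h2]; exact h1

theorem Matrix.PosSemidef.elimStep_row {ι : Type*} [Fintype ι] [DecidableEq ι]
    {N : Matrix ι ι ℝ} (hN : N.PosSemidef) (l b : ι) : _root_.elimStep N l l b = 0 := by
  simp only [_root_.elimStep]
  by_cases h0 : N l l = 0
  · simp [h0, hN.apply_eq_zero_of_diag h0 b]
  · field_simp
    ring

theorem elimStep_row_of_zero {ι : Type*} {N : Matrix ι ι ℝ} {a : ι} (h : ∀ b, N a b = 0)
    (l b : ι) : elimStep N l a b = 0 := by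
  simp [elimStep, h]

theorem posSemidef_of_elimStep {ι : Type*} [Fintype ι] {N : Matrix ι ι ℝ} (hN : Nᵀ = N) {l : ι}
    (hl : 0 ≤ N l l) (h : (elimStep N l).PosSemidef) : N.PosSemidef := by
  refine posSemidef_of_transpose_eq hN fun x => ?_
  have h1 := h.dotProduct_mulVec_nonneg x
  rw [star_trivial, dotProduct_elimStep_mulVec hN] at h1
  have h2 : 0 ≤ (N l ⬝ᵥ x) ^ 2 / N l l := by positivity
  linarith

/-- The first `k` steps of symmetric elimination. -/
noncomputable def elim {d : ℕ} (N : Matrix (Fin (d + 1)) (Fin (d + 1)) ℝ) :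
    ℕ → Matrix (Fin (d + 1)) (Fin (d + 1)) ℝ
  | 0 => N
  | k + 1 => elimStep (elim N k) (Fin.ofNat (d + 1) k)

theorem elim_transpose {d : ℕ} {N : Matrix (Fin (d + 1)) (Fin (d + 1)) ℝ} (hN : Nᵀ = N) (k : ℕ) :
    (elim N k)ᵀ = elim N k := by
  induction k with
  | zero => exact hN
  | succ k ih => exact elimStep_transpose ih _

theorem Matrix.PosSemidef.elim {d : ℕ} {N : Matrix (Fin (d + 1)) (Fin (d + 1)) ℝ}
    (hN : N.PosSemidef) (k : ℕ) : (elim N k).PosSemidef := by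
  induction k with
  | zero => exact hN
  | succ k ih => exact ih.elimStep _

theorem Matrix.PosSemidef.elim_row {d : ℕ} {N : Matrix (Fin (d + 1)) (Fin (d + 1)) ℝ}
    (hN : N.PosSemidef) {k : ℕ} (hk : k ≤ d) {a : Fin (d + 1)} (ha : (a : ℕ) < k)
    (b : Fin (d + 1)) : _root_.elim N k a b = 0 := by
  induction k generalizing b with
  | zero => omega
  | succ k ih =>
    rcases Nat.lt_succ_iff_lt_or_eq.1 ha with h | h
    · exact elimStep_row_of_zero (fun b => ih (by omega) h b) _ b
    · have e : a = Fin.ofNat (d + 1) k := by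
        ext; simp [h, Nat.mod_eq_of_lt (show k < d + 1 by omega)]
      rw [e]
      exact (hN.elim k).elimStep_row _ b

/-- The last row and column are never used as pivot during the first `d` steps, so a change of the
corner is carried along untouched. -/
theorem elim_add_single_last {d : ℕ} (N : Matrix (Fin (d + 1)) (Fin (d + 1)) ℝ) (c : ℝ) {k : ℕ}
    (hk : k ≤ d) :
    elim (N + Matrix.single (Fin.last d) (Fin.last d) c) k
      = elim N k + Matrix.single (Fin.last d) (Fin.last d) c := by
  induction k with
  | zero => rfl
  | succ k ih =>
    have hne : Fin.last d ≠ Fin.ofNat (d + 1) k := fun e => by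
      have := congrArg Fin.val e
      simp [Nat.mod_eq_of_lt (show k < d + 1 by omega)] at this
      omega
    rw [elim, ih (by omega), elim]
    ext a b
    simp only [elimStep, Matrix.add_apply, Matrix.single_apply, hne, and_false, false_and, if_false,
      add_zero]
    ring

/-- Elimination decides positive semidefiniteness of a symmetric matrix which is positive
semidefinite up to its last diagonal entry. -/
theorem elim_last_nonneg_iff {d : ℕ} {N : Matrix (Fin (d + 1)) (Fin (d + 1)) ℝ} (hN : Nᵀ = N)
    {c : ℝ} (hc : (N + Matrix.single (Fin.last d) (Fin.last d) c).PosSemidef) :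
    0 ≤ elim N d (Fin.last d) (Fin.last d) ↔ N.PosSemidef := by
  refine ⟨fun h => ?_, fun h => (h.elim d).diag_nonneg⟩
  have hne : ∀ {a : Fin (d + 1)}, (a : ℕ) < d → Fin.last d ≠ a := fun ha e => by
    rw [← e, Fin.val_last] at ha; omega
  -- After `d` steps all rows but the last vanish for the semidefinite matrix with raised corner,
  -- hence also for `N`, which differs from it only in the corner.
  have hrow : ∀ a b : Fin (d + 1), (a : ℕ) < d → elim N d a b = 0 := fun a b ha => by
    have := hc.elim_row le_rfl ha b
    rwa [elim_add_single_last N c le_rfl, Matrix.add_apply, Matrix.single_apply,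
      if_neg fun e => hne ha e.1, add_zero] at this
  have hlast : elim N d
      = Matrix.single (Fin.last d) (Fin.last d) (elim N d (Fin.last d) (Fin.last d)) := by
    ext a b
    rw [Matrix.single_apply]
    split_ifs with hab
    · obtain ⟨rfl, rfl⟩ := hab
      rfl
    · by_cases ha : (a : ℕ) < d
      · exact hrow a b ha
      · have hb : (b : ℕ) < d := by
          by_contra hb
          exact hab ⟨Fin.ext (by simp; omega), Fin.ext (by simp; omega)⟩
        rw [← elim_transpose hN d, transpose_apply]
        exact hrow b a hb
  -- Semidefiniteness is carried back through the steps; every pivot is nonnegative because it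
  -- equals that of the matrix with raised corner.
  have hdown : ∀ j ≤ d, (elim N (d - j)).PosSemidef := by
    intro j
    induction j with
    | zero =>
      intro _
      rw [Nat.sub_zero]
      refine posSemidef_of_transpose_eq (elim_transpose hN d) fun x => ?_
      rw [hlast, dotProduct_single_mulVec]
      positivity
    | succ j ih =>
      intro hj
      have e : d - j = d - (j + 1) + 1 := by omega
      have h1 := ih (by omega)
      rw [e] at h1
      refine posSemidef_of_elimStep (elim_transpose hN _) ?_ h1
      have h2 := (hc.elim (d - (j + 1))).diag_nonneg (i := Fin.ofNat (d + 1) (d - (j + 1)))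
      rwa [elim_add_single_last N c (by omega), Matrix.add_apply, Matrix.single_apply, if_neg,
        add_zero] at h2
      exact fun e => hne (by simp [Nat.mod_eq_of_lt (show d - (j + 1) < d + 1 by omega)]; omega) e.1
  simpa [elim] using hdown d le_rfl

/-! ### The ellipsoid test -/

/-- The vector `v` followed by a zero. -/
def extend {d : ℕ} (v : Fin d → ℝ) : Fin (d + 1) → ℝ := Fin.snoc v 0

theorem extend_dotProduct {d : ℕ} (v : Fin d → ℝ) (z : Fin (d + 1) → ℝ) :
    extend v ⬝ᵥ z = v ⬝ᵥ fun a => z a.castSucc := by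
  simp [extend, dotProduct, Fin.sum_univ_castSucc]

/-- The bordered matrix with upper left block `S`, last row and column `v`, and corner `1`. -/
def bordered {d : ℕ} (S : Matrix (Fin (d + 1)) (Fin (d + 1)) ℝ) (v : Fin d → ℝ) :
    Matrix (Fin (d + 1)) (Fin (d + 1)) ℝ :=
  S + vecMulVec (extend v) (Pi.single (Fin.last d) 1)
    + vecMulVec (Pi.single (Fin.last d) 1) (extend v) + Matrix.single (Fin.last d) (Fin.last d) 1

theorem bordered_transpose {d : ℕ} {S : Matrix (Fin (d + 1)) (Fin (d + 1)) ℝ} (hS : Sᵀ = S)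
    (v : Fin d → ℝ) : (bordered S v)ᵀ = bordered S v := by
  simp only [bordered, transpose_add, hS, transpose_vecMulVec, transpose_single]
  rw [add_right_comm S]

theorem dotProduct_bordered_add_single_mulVec {d : ℕ} (S : Matrix (Fin (d + 1)) (Fin (d + 1)) ℝ)
    (v : Fin d → ℝ) (c : ℝ) (z : Fin (d + 1) → ℝ) :
    z ⬝ᵥ ((bordered S v + Matrix.single (Fin.last d) (Fin.last d) c) *ᵥ z)
      = z ⬝ᵥ (S *ᵥ z) + 2 * z (Fin.last d) * (v ⬝ᵥ fun a => z a.castSucc)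
        + (1 + c) * z (Fin.last d) ^ 2 := by
  simp only [bordered, add_mulVec, dotProduct_add, dotProduct_single_mulVec, vecMulVec_mulVec]
  simp [← extend_dotProduct, dotProduct_comm z]
  ring

/-- Schur complement: the bordered matrix is positive semidefinite exactly when `v vᵀ ≼ S`. The weak
bound with `K` makes it so after the corner is raised to `K`, as the elimination criterion requires.
-/
theorem elim_bordered_last_nonneg_iff {d : ℕ} {S : Matrix (Fin (d + 1)) (Fin (d + 1)) ℝ}
    (hS : Sᵀ = S) {q : (Fin d → ℝ) → ℝ}
    (hq : ∀ z : Fin (d + 1) → ℝ, z ⬝ᵥ (S *ᵥ z) = q fun a => z a.castSucc) {v : Fin d → ℝ} {K : ℝ}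
    (hK : 0 < K) (hv : ∀ y, (v ⬝ᵥ y) ^ 2 ≤ K * q y) :
    0 ≤ elim (bordered S v) d (Fin.last d) (Fin.last d) ↔ ∀ y, (v ⬝ᵥ y) ^ 2 ≤ q y := by
  have hsym := bordered_transpose hS v
  have hc : (bordered S v + Matrix.single (Fin.last d) (Fin.last d) (K - 1)).PosSemidef := by
    refine posSemidef_of_transpose_eq (by rw [transpose_add, hsym, transpose_single]) fun z => ?_
    rw [dotProduct_bordered_add_single_mulVec, hq]
    have h1 := hv fun a => z a.castSucc
    set t := z (Fin.last d)
    set p := v ⬝ᵥ fun a => z a.castSucc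
    set r := q fun a => z a.castSucc
    -- The product equals `(K r - p²) + (K t + p)²`.
    have h2 : 0 ≤ K * (r + 2 * t * p + (1 + (K - 1)) * t ^ 2) := by nlinarith [sq_nonneg (K * t + p)]
    exact nonneg_of_mul_nonneg_right h2 hK
  rw [elim_last_nonneg_iff hsym hc]
  have hquad := dotProduct_bordered_add_single_mulVec S v 0
  simp only [Matrix.single_zero, add_zero, one_mul, hq] at hquad
  constructor
  · intro h y
    -- The last coordinate `-⟨v, y⟩` minimizes the bordered form, with value `q y - ⟨v, y⟩²`.
    have h1 := h.dotProduct_mulVec_nonneg (Fin.snoc y (-(v ⬝ᵥ y)) : Fin (d + 1) → ℝ)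
    rw [star_trivial, hquad] at h1
    simp only [Fin.snoc_last, Fin.snoc_castSucc] at h1
    nlinarith
  · intro h
    refine posSemidef_of_transpose_eq hsym fun z => ?_
    rw [hquad]
    nlinarith [h fun a => z a.castSucc, sq_nonneg (z (Fin.last d) + v ⬝ᵥ fun a => z a.castSucc)]

/-- The Gram form of a subfamily, bordered by zeros. -/
def gramSum {d n : ℕ} (v : Fin n → Fin d → ℝ) (W : Finset (Fin n)) :
    Matrix (Fin (d + 1)) (Fin (d + 1)) ℝ :=
  ∑ i ∈ W, vecMulVec (extend (v i)) (extend (v i))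

theorem gramSum_transpose {d n : ℕ} (v : Fin n → Fin d → ℝ) (W : Finset (Fin n)) :
    (gramSum v W)ᵀ = gramSum v W := by
  simp [gramSum, transpose_sum, transpose_vecMulVec]

theorem dotProduct_gramSum_mulVec {d n : ℕ} (v : Fin n → Fin d → ℝ) (W : Finset (Fin n))
    (z : Fin (d + 1) → ℝ) :
    z ⬝ᵥ (gramSum v W *ᵥ z) = ∑ i ∈ W, (v i ⬝ᵥ fun a => z a.castSucc) ^ 2 := by
  simp [gramSum, sum_mulVec, dotProduct_sum, dotProduct_vecMulVec_mulVec, extend_dotProduct]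

theorem elim_bordered_gramSum_last_nonneg_iff {d n : ℕ} {v : Fin n → Fin d → ℝ} {W : Finset (Fin n)}
    (hW : Covers v W) (U : Finset (Fin n)) (i : Fin n) :
    0 ≤ elim (bordered ((2 * (W.card : ℝ))⁻¹ • gramSum v W + gramSum v U) (v i)) d
        (Fin.last d) (Fin.last d) ↔
      ∀ y, (v i ⬝ᵥ y) ^ 2 ≤
        (2 * (W.card : ℝ))⁻¹ * ∑ k ∈ W, (v k ⬝ᵥ y) ^ 2 + ∑ j ∈ U, (v j ⬝ᵥ y) ^ 2 := by
  -- Covering gives `⟨v i, y⟩² ≤ 2 T = 4|W| · T / (2|W|)`; the extra 1 in `K` keeps it positive when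
  -- `W` is empty.
  refine elim_bordered_last_nonneg_iff
    (q := fun y => (2 * (W.card : ℝ))⁻¹ * ∑ k ∈ W, (v k ⬝ᵥ y) ^ 2 + ∑ j ∈ U, (v j ⬝ᵥ y) ^ 2)
    (by rw [transpose_add, transpose_smul, gramSum_transpose, gramSum_transpose]) (fun z => ?_)
    (K := 4 * W.card + 1) (by positivity) fun y => ?_
  · simp only [add_mulVec, smul_mulVec, dotProduct_add, dotProduct_smul, dotProduct_gramSum_mulVec,
      smul_eq_mul]
  · have h := hW i y
    set T := ∑ k ∈ W, (v k ⬝ᵥ y) ^ 2 with hT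
    have hT0 : 0 ≤ T := by positivity
    have hU0 : 0 ≤ ∑ j ∈ U, (v j ⬝ᵥ y) ^ 2 := by positivity
    rcases W.eq_empty_or_nonempty with rfl | hne
    · have : T = 0 := by simp [hT]
      simp [this] at h ⊢
      rw [h]; simpa using hU0
    · have hm : (0 : ℝ) < W.card := by exact_mod_cast hne.card_pos
      have e : 4 * W.card * ((2 * (W.card : ℝ))⁻¹ * T) = 2 * T := by field_simp; ring
      have h0 : 0 ≤ (2 * (W.card : ℝ))⁻¹ * T := by positivity
      have h1 : 0 ≤ 4 * W.card * ∑ j ∈ U, (v j ⬝ᵥ y) ^ 2 := by positivity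
      rw [add_mul, mul_add]
      linarith

/-! ### Reasoning about programs -/

namespace RealRAM

/-- Started in `s`, the program `p` halts within `T` steps in a store with the property `Q`. -/
def Runs (p : Prog) (s : Store) (T : ℕ) (Q : Store → Prop) : Prop :=
  ∃ s' t, Exec p s s' t ∧ t ≤ T ∧ Q s'

theorem Runs.mono {p : Prog} {s : Store} {T T' : ℕ} {Q Q' : Store → Prop} (h : Runs p s T Q)
    (hT : T ≤ T') (hQ : ∀ s', Q s' → Q' s') : Runs p s T' Q' := by
  obtain ⟨s', t, he, ht, hq⟩ := h
  exact ⟨s', t, he, ht.trans hT, hQ s' hq⟩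

theorem Runs.skip {s : Store} {Q : Store → Prop} (h : Q s) : Runs .skip s 1 Q :=
  ⟨s, 1, .skip s, le_rfl, h⟩

theorem Runs.setNat {s : Store} {a : ℕ} {i x : NExpr} {Q : Store → Prop}
    (h : Q (s.writeNat a (i.eval s) (x.eval s))) : Runs (.setNat a i x) s 1 Q :=
  ⟨_, 1, .setNat s a i x, le_rfl, h⟩

theorem Runs.setReal {s : Store} {a : ℕ} {i j : NExpr} {x : RExpr} {Q : Store → Prop}
    (h : Q (s.writeReal a (i.eval s) (j.eval s) (x.eval s))) : Runs (.setReal a i j x) s 1 Q :=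
  ⟨_, 1, .setReal s a i j x, le_rfl, h⟩

theorem Runs.seq {p q : Prog} {s : Store} {T₁ T₂ : ℕ} {Q : Store → Prop}
    (h : Runs p s T₁ fun s' => Runs q s' T₂ Q) : Runs (.seq p q) s (T₁ + T₂) Q := by
  obtain ⟨s₁, t₁, he₁, ht₁, s₂, t₂, he₂, ht₂, hq⟩ := h
  exact ⟨s₂, t₁ + t₂, .seq he₁ he₂, by omega, hq⟩

theorem Runs.ite {b : Test} {p q : Prog} {s : Store} {T : ℕ} {Q : Store → Prop}
    (h₁ : b.Holds s → Runs p s T Q) (h₂ : ¬ b.Holds s → Runs q s T Q) :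
    Runs (.ite b p q) s (T + 1) Q := by
  by_cases hb : b.Holds s
  · obtain ⟨s', t, he, ht, hq⟩ := h₁ hb
    exact ⟨s', t + 1, .iteTrue hb he, by omega, hq⟩
  · obtain ⟨s', t, he, ht, hq⟩ := h₂ hb
    exact ⟨s', t + 1, .iteFalse hb he, by omega, hq⟩

/-- The variable `a` is the cell `0` of the array `a` of naturals. -/
def var (a : ℕ) : NExpr := .get a (.lit 0)

/-- `for a = 0, …, bound - 1 do body` -/
def forLoop (a : ℕ) (bound : NExpr) (body : Prog) : Prog :=
  .seq (.setNat a (.lit 0) (.lit 0))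
    (.loop (.not (.natLE bound (var a)))
      (.seq body (.setNat a (.lit 0) (.add (var a) (.lit 1)))))

/-- Rule for loops with invariant `I`, which has to be restored after the counter is incremented. A
round costs the body, the increment and the test; the initialization and the final test add 2. -/
theorem Runs.forLoop {a : ℕ} {bound : NExpr} {body : Prog} {s : Store} {N T : ℕ}
    {Q : Store → Prop} (I : ℕ → Store → Prop) (h0 : I 0 (s.writeNat a 0 0))
    (hbound : ∀ j s, I j s → bound.eval s = N) (hvar : ∀ j s, I j s → s.nat a 0 = j)
    (hstep : ∀ j < N, ∀ s, I j s →
      Runs body s T fun s' => I (j + 1) (s'.writeNat a 0 (s'.nat a 0 + 1)))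
    (hQ : ∀ s, I N s → Q s) : Runs (forLoop a bound body) s (N * (T + 2) + 2) Q := by
  have hloop : ∀ m j, j + m = N → ∀ s, I j s →
      Runs (.loop (.not (.natLE bound (var a)))
        (.seq body (.setNat a (.lit 0) (.add (var a) (.lit 1))))) s (m * (T + 2) + 1) Q := by
    intro m
    induction m with
    | zero =>
      intro j hj s hs
      refine ⟨s, 1, .loopFalse ?_, by omega, hQ s (by rwa [← hj])⟩
      simp only [Test.Holds, not_not, hbound j s hs, var, NExpr.eval, hvar j s hs]
      omega
    | succ m ih =>
      intro j hj s hs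
      obtain ⟨s₁, t₁, he₁, ht₁, hI⟩ := hstep j (by omega) s hs
      obtain ⟨s₂, t₂, he₂, ht₂, hq⟩ := ih (j + 1) (by omega) _ hI
      refine ⟨s₂, t₁ + 1 + t₂ + 1, .loopTrue ?_ (.seq he₁ (.setNat s₁ _ _ _)) he₂, ?_, hq⟩
      · simp only [Test.Holds, hbound j s hs, var, NExpr.eval, hvar j s hs]
        omega
      · rw [Nat.succ_mul]; omega
  refine (Runs.seq (T₁ := 1) (T₂ := N * (T + 2) + 1) (Runs.setNat ?_)).mono (by omega)
    fun _ h => h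
  exact hloop N 0 (by omega) _ h0

/-- `s'` differs from `s` at most in the real array `A` and the variables `5` and `6`. -/
def AgreeOff (A : ℕ) (s s' : Store) : Prop :=
  (∀ c, c ≠ 5 → c ≠ 6 → s'.nat c = s.nat c) ∧ ∀ B, B ≠ A → s'.real B = s.real B

/-- Set the entries of the real array `A` with both indices at most `d` to the value of `e`, in
which the variables `5` and `6` stand for the indices. -/
def fill (A : ℕ) (e : RExpr) : Prog :=
  forLoop 5 (.add (var 0) (.lit 1))
    (forLoop 6 (.add (var 0) (.lit 1)) (.setReal A (var 5) (var 6) e))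

/-- A bound for the running time of `fill`. -/
def fillTime (d : ℕ) : ℕ := (d + 1) * ((d + 1) * (1 + 2) + 2 + 2) + 2

/-- The update happens in place. The hypothesis on `e` lets it read the old value of `A` only at the
current entry, which has not yet been overwritten. -/
theorem runs_fill {A d : ℕ} {e : RExpr} {s : Store} (hd : s.nat 0 0 = d) (f : ℕ → ℕ → ℝ)
    (he : ∀ s' a b, a ≤ d → b ≤ d → AgreeOff A s s' → s'.nat 5 0 = a → s'.nat 6 0 = b →
      s'.real A a b = s.real A a b → e.eval s' = f a b) :
    Runs (fill A e) s (fillTime d) fun s' =>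
      AgreeOff A s s' ∧ ∀ a b, a ≤ d → b ≤ d → s'.real A a b = f a b := by
  refine Runs.forLoop (N := d + 1)
    (fun a s' => AgreeOff A s s' ∧ s'.nat 5 0 = a ∧
      ∀ a' b', s'.real A a' b' = if a' < a ∧ b' ≤ d then f a' b' else s.real A a' b')
    ?_ ?_ (fun _ _ h => h.2.1) ?_ ?_
  · refine ⟨⟨fun c h5 _ => ?_, fun _ _ => rfl⟩, ?_, ?_⟩
    · simp [Store.writeNat, h5]
    · simp [Store.writeNat]
    · simp [Store.writeNat]
  · rintro j s' ⟨⟨hn, -⟩, -, -⟩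
    simp [NExpr.eval, var, hn 0, hd]
  · rintro a ha s₁ ⟨⟨hn₁, hr₁⟩, h5₁, hv₁⟩
    refine Runs.forLoop (N := d + 1)
      (fun b s' => AgreeOff A s s' ∧ s'.nat 5 0 = a ∧ s'.nat 6 0 = b ∧
        ∀ a' b', s'.real A a' b' = if (a' < a ∧ b' ≤ d) ∨ (a' = a ∧ b' < b) then f a' b'
          else s.real A a' b')
      ?_ ?_ (fun _ _ h => h.2.2.1) ?_ ?_
    · refine ⟨⟨fun c h5 h6 => ?_, hr₁⟩, ?_, ?_, ?_⟩
      · simp [Store.writeNat, h6, hn₁ c h5 h6]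
      · simpa [Store.writeNat] using h5₁
      · simp [Store.writeNat]
      · simpa [Store.writeNat] using hv₁
    · rintro j s' ⟨⟨hn, -⟩, -, -⟩
      simp [NExpr.eval, var, hn 0, hd]
    · rintro b hb s₂ ⟨⟨hn₂, hr₂⟩, h5₂, h6₂, hv₂⟩
      refine Runs.setReal ?_
      have hval : e.eval s₂ = f a b :=
        he s₂ a b (by omega) (by omega) ⟨hn₂, hr₂⟩ h5₂ h6₂ (by rw [hv₂, if_neg (by omega)])
      rw [hval]
      refine ⟨⟨fun c h5 h6 => ?_, fun B hB => ?_⟩, ?_, ?_, ?_⟩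
      · simp [Store.writeNat, Store.writeReal, h6, hn₂ c h5 h6]
      · simp [Store.writeNat, Store.writeReal, hB, hr₂ B hB]
      · simpa [Store.writeNat, Store.writeReal] using h5₂
      · simp [Store.writeNat, Store.writeReal, h6₂]
      · intro a' b'
        simp only [Store.writeNat, Store.writeReal, Function.update_self, var, NExpr.eval, h5₂, h6₂]
        by_cases ha' : a' = a
        · subst ha'
          rw [Function.update_self]
          by_cases hb' : b' = b
          · subst hb'
            rw [Function.update_self, if_pos (by omega)]
          · rw [Function.update_of_ne hb', hv₂]
            congr 1
            apply propext
            omega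
        · rw [Function.update_of_ne ha', hv₂]
          congr 1
          apply propext
          omega
    · rintro s' ⟨⟨hn, hr⟩, h5, h6, hv⟩
      refine ⟨⟨fun c h5 h6 => ?_, hr⟩, ?_, fun a' b' => ?_⟩
      · simp [Store.writeNat, h5, hn c h5 h6]
      · simp [Store.writeNat, h5]
      · simp only [Store.writeNat, hv]
        congr 1
        apply propext
        omega
  · rintro s' ⟨hag, -, hv⟩
    exact ⟨hag, fun a b ha hb => by rw [hv, if_pos (by omega)]⟩

end RealRAM

namespace RealRAM

/-! ### The spanner program -/

/-- The block of the real array `A` with indices at most `d`. -/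
def Store.block (d : ℕ) (s : Store) (A : ℕ) : Matrix (Fin (d + 1)) (Fin (d + 1)) ℝ :=
  fun a b => s.real A a b

theorem Store.block_congr {d A : ℕ} {s s' : Store} (h : s'.real A = s.real A) :
    s'.block d A = s.block d A := by
  ext a b
  simp only [Store.block, h]

theorem Store.block_writeNat (d : ℕ) (s : Store) (a i x A : ℕ) :
    (s.writeNat a i x).block d A = s.block d A := rfl

theorem runs_fill_block {A d : ℕ} {e : RExpr} {s : Store} (hd : s.nat 0 0 = d)
    (M : Matrix (Fin (d + 1)) (Fin (d + 1)) ℝ)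
    (he : ∀ s' (a b : Fin (d + 1)), AgreeOff A s s' → s'.nat 5 0 = a → s'.nat 6 0 = b →
      s'.real A a b = s.block d A a b → e.eval s' = M a b) :
    Runs (fill A e) s (fillTime d) fun s' => AgreeOff A s s' ∧ s'.block d A = M := by
  have hof : ∀ a, a ≤ d → ((Fin.ofNat (d + 1) a : Fin (d + 1)) : ℕ) = a := fun a ha => by
    simp [Nat.mod_eq_of_lt (show a < d + 1 by omega)]
  refine (runs_fill hd (fun a b => M (Fin.ofNat (d + 1) a) (Fin.ofNat (d + 1) b))
    fun s' a b ha hb hag h5 h6 hr => ?_).mono le_rfl fun s' h => ⟨h.1, ?_⟩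
  · exact he s' _ _ hag (by rw [h5, hof a ha]) (by rw [h6, hof b hb])
      (by simp only [Store.block, hof a ha, hof b hb, hr])
  · ext a b
    rw [Store.block, h.2 a b (by omega) (by omega)]
    congr 1 <;> ext <;> simp

/-- The store `s` still holds the input `v`. -/
def HasInput {d n : ℕ} (v : Fin n → Fin d → ℝ) (s : Store) : Prop :=
  s.nat 0 = (inputStore v).nat 0 ∧ s.real 0 = (inputStore v).real 0

section HasInput

variable {d n : ℕ} {v : Fin n → Fin d → ℝ} {s s' : Store}

theorem HasInput.dim (h : HasInput v s) : s.nat 0 0 = d := by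
  rw [h.1]; simp [inputStore]

theorem HasInput.count (h : HasInput v s) : s.nat 0 1 = n := by
  rw [h.1]; simp [inputStore]

/-- The cells beyond the input are 0, so column `d` supplies the padding coordinate. -/
theorem HasInput.real_eq (h : HasInput v s) (i : Fin n) (a : Fin (d + 1)) :
    s.real 0 i a = extend (v i) a := by
  rw [h.2]
  refine Fin.lastCases ?_ (fun a => ?_) a
  · simp [inputStore, extend]
  · simp [inputStore, extend]

theorem HasInput.of_agreeOff (h : HasInput v s) {A : ℕ} (hA : A ≠ 0) (hag : AgreeOff A s s') :
    HasInput v s' :=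
  ⟨(hag.1 0 (by norm_num) (by norm_num)).trans h.1, (hag.2 0 hA.symm).trans h.2⟩

theorem HasInput.writeNat (h : HasInput v s) {a i x : ℕ} (ha : a ≠ 0) :
    HasInput v (s.writeNat a i x) :=
  ⟨by simpa [Store.writeNat, ha.symm] using h.1, h.2⟩

end HasInput

/-- The indices marked in the array `1` of naturals. -/
def Store.marked (n : ℕ) (s : Store) : Finset (Fin n) :=
  Finset.univ.filter fun i : Fin n => s.nat 1 i ≠ 0

theorem Store.mem_marked {n : ℕ} {s : Store} {i : Fin n} : i ∈ s.marked n ↔ s.nat 1 i ≠ 0 := by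
  simp [Store.marked]

theorem Store.marked_congr {n : ℕ} {s s' : Store} (h : s'.nat 1 = s.nat 1) :
    s'.marked n = s.marked n := by
  simp [Store.marked, h]

/-- The members of `W` below `j`. -/
def below {n : ℕ} (W : Finset (Fin n)) (j : ℕ) : Finset (Fin n) :=
  W.filter fun i => (i : ℕ) < j

theorem below_zero {n : ℕ} (W : Finset (Fin n)) : below W 0 = ∅ := by simp [below]

theorem below_self {n : ℕ} (W : Finset (Fin n)) : below W n = W := by simp [below]

theorem below_succ_of_mem {n : ℕ} {W : Finset (Fin n)} {i : Fin n} (hi : i ∈ W) :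
    below W (i + 1) = insert i (below W i) := by
  ext k
  simp only [below, Finset.mem_filter, Finset.mem_insert, Nat.lt_succ_iff_lt_or_eq, Fin.val_inj]
  constructor
  · rintro ⟨h1, h2 | h2⟩
    · exact Or.inr ⟨h1, h2⟩
    · exact Or.inl h2
  · rintro (rfl | h)
    · exact ⟨hi, Or.inr rfl⟩
    · exact ⟨h.1, Or.inl h.2⟩

theorem below_succ_of_notMem {n : ℕ} {W : Finset (Fin n)} {i : Fin n} (hi : i ∉ W) :
    below W (i + 1) = below W i := by
  ext k
  simp only [below, Finset.mem_filter, Nat.lt_succ_iff_lt_or_eq, Fin.val_inj]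
  constructor
  · rintro ⟨h1, h2 | rfl⟩
    · exact ⟨h1, h2⟩
    · exact absurd h1 hi
  · exact fun h => ⟨h.1, Or.inl h.2⟩

theorem notMem_below_self {n : ℕ} (W : Finset (Fin n)) (i : Fin n) : i ∉ below W i := by
  simp [below]

theorem gramSum_insert {d n : ℕ} (v : Fin n → Fin d → ℝ) {W : Finset (Fin n)} {i : Fin n}
    (hi : i ∉ W) : gramSum v (insert i W)
      = gramSum v W + vecMulVec (extend (v i)) (extend (v i)) := by
  rw [gramSum, Finset.sum_insert hi, gramSum]
  exact add_comm _ _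

/-- The entry of the real array `A` at the current indices. -/
def entry (A : ℕ) : RExpr := .get A (var 5) (var 6)

/-- The number of input vectors. -/
def countExpr : NExpr := .get 0 (.lit 1)

/-- Add `vᵢ vᵢᵀ` to the real array `1`, where `i` is the variable `3`. -/
def addOuter : Prog :=
  fill 1 (.add (entry 1) (.mul (.get 0 (var 3) (var 5)) (.get 0 (var 3) (var 6))))

theorem runs_addOuter {d n : ℕ} {v : Fin n → Fin d → ℝ} {s : Store} (h : HasInput v s)
    {i : Fin n} (hi : s.nat 3 0 = i) :
    Runs addOuter s (fillTime d) fun s' => AgreeOff 1 s s' ∧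
      s'.block d 1 = s.block d 1 + vecMulVec (extend (v i)) (extend (v i)) := by
  refine runs_fill_block h.dim _ fun s' a b hag h5 h6 hr => ?_
  have hin := h.of_agreeOff one_ne_zero hag
  simp only [RExpr.eval, entry, var, NExpr.eval, h5, h6, hag.1 3 (by norm_num) (by norm_num), hi,
    hin.real_eq, hr, Matrix.add_apply, vecMulVec_apply]

/-- Compute in the real array `1` the scaled Gram form of the marked vectors. -/
def gramProg : Prog :=
  .seq (.setNat 7 (.lit 0) (.lit 0)) <| .seq (fill 1 (.ofNat (.lit 0))) <|
  .seq (forLoop 3 countExpr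
    (.ite (.natLE (.lit 1) (.get 1 (var 3)))
      (.seq (.setNat 7 (.lit 0) (.add (var 7) (.lit 1))) addOuter) .skip))
  (fill 1 (.div (entry 1) (.ofNat (.add (var 7) (var 7)))))

/-- A bound for the running time of `gramProg`. -/
def gramTime (d n : ℕ) : ℕ :=
  1 + (fillTime d + (n * (1 + fillTime d + 1 + 2) + 2 + fillTime d))

theorem runs_gramProg {d n : ℕ} {v : Fin n → Fin d → ℝ} {s : Store} (h : HasInput v s) :
    Runs gramProg s (gramTime d n) fun s' => HasInput v s' ∧ s'.nat 1 = s.nat 1 ∧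
      s'.nat 2 = s.nat 2 ∧
      s'.block d 1 = (2 * ((s.marked n).card : ℝ))⁻¹ • gramSum v (s.marked n) := by
  set W := s.marked n with hW
  refine .seq (.setNat (.seq ?_))
  refine (runs_fill_block (d := d) ((h.writeNat (by norm_num)).dim) 0
    fun s' a b _ _ _ _ => by simp [RExpr.eval, NExpr.eval]).mono le_rfl ?_
  rintro s₁ ⟨hag₁, hS₁⟩
  have hin₁ : HasInput v s₁ := (h.writeNat (by norm_num)).of_agreeOff one_ne_zero hag₁
  -- Variable 7 counts the marked vectors met so far. Array 2 of naturals holds the counter of the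
  -- outermost loop, so it must be preserved throughout.
  refine .seq (Runs.forLoop (N := n) (fun j s' => HasInput v s' ∧ s'.nat 1 = s.nat 1 ∧
    s'.nat 2 = s.nat 2 ∧ s'.nat 3 0 = j ∧ s'.nat 7 0 = (below W j).card ∧
    s'.block d 1 = gramSum v (below W j)) ?_ ?_ (fun _ _ h => h.2.2.2.1) ?_ ?_)
  · refine ⟨hin₁.writeNat (by norm_num), ?_, ?_, ?_, ?_, ?_⟩
    · simp [Store.writeNat, hag₁.1 1]
    · simp [Store.writeNat, hag₁.1 2]
    · simp [Store.writeNat]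
    · simp [Store.writeNat, hag₁.1 7, below_zero, NExpr.eval]
    · rw [below_zero, show gramSum v ∅ = 0 from Finset.sum_empty]
      exact hS₁
  · rintro j s' ⟨hin, -⟩
    exact hin.count
  · rintro j hj s₂ ⟨hin, h1, h2, h3, h7, hS⟩
    set i : Fin n := ⟨j, hj⟩ with hi
    have hmem : i ∈ W ↔ 1 ≤ s₂.nat 1 j := by
      rw [hW, Store.mem_marked, h1, Nat.one_le_iff_ne_zero]
    refine .ite (fun hb => ?_) fun hb => ?_
    · have hiW : i ∈ W := hmem.2 (by simpa [Test.Holds, NExpr.eval, var, h3] using hb)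
      have e := below_succ_of_mem hiW
      refine .seq (.setNat ?_)
      refine (runs_addOuter (i := i) (hin.writeNat (by norm_num)) (by
        simpa [Store.writeNat] using h3)).mono le_rfl ?_
      rintro s₃ ⟨hag, hS₃⟩
      refine ⟨((hin.writeNat (by norm_num)).of_agreeOff one_ne_zero hag).writeNat (by norm_num),
        ?_, ?_, ?_, ?_, ?_⟩
      · simp [Store.writeNat, hag.1 1, h1]
      · simp [Store.writeNat, hag.1 2, h2]
      · simp [Store.writeNat, hag.1 3, h3]
      · rw [show j + 1 = (i : ℕ) + 1 from rfl, e,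
          Finset.card_insert_of_notMem (notMem_below_self W i)]
        simp [Store.writeNat, hag.1 7, NExpr.eval, var, h7, hi]
      · rw [show j + 1 = (i : ℕ) + 1 from rfl, e, gramSum_insert v (notMem_below_self W i)]
        refine Eq.trans ?_ (hS₃.trans ?_)
        · rfl
        · congr 1
    · have hiW : i ∉ W := fun h => hb (by
        simpa [Test.Holds, NExpr.eval, var, h3] using hmem.1 h)
      have e := below_succ_of_notMem hiW
      refine (Runs.skip ?_).mono (by omega) fun _ h => h
      refine ⟨hin.writeNat (by norm_num), ?_, ?_, ?_, ?_, ?_⟩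
      · simp [Store.writeNat, h1]
      · simp [Store.writeNat, h2]
      · simp [Store.writeNat, h3]
      · rw [show j + 1 = (i : ℕ) + 1 from rfl, e]
        simpa [Store.writeNat] using h7
      · rw [show j + 1 = (i : ℕ) + 1 from rfl, e]
        exact hS
  · rintro s₂ ⟨hin, h1, h2, -, h7, hS⟩
    rw [below_self] at h7 hS
    refine (runs_fill_block hin.dim ((2 * (W.card : ℝ))⁻¹ • gramSum v W)
      fun s' a b hag h5 h6 hr => ?_).mono le_rfl ?_
    · simp only [RExpr.eval, entry, var, NExpr.eval, h5, h6,
        hag.1 7 (by norm_num) (by norm_num), h7, hr, hS, Matrix.smul_apply, smul_eq_mul]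
      push_cast
      rw [div_eq_inv_mul, two_mul]
    · rintro s' ⟨hag, hS'⟩
      exact ⟨hin.of_agreeOff one_ne_zero hag, by rw [hag.1 1 (by norm_num) (by norm_num), h1],
        by rw [hag.1 2 (by norm_num) (by norm_num), h2], hS'⟩

/-- Symmetric elimination in the real array `2`. -/
def elimProg : Prog :=
  forLoop 4 (var 0) <| .seq (fill 3 (entry 2)) <|
    fill 2 (.sub (entry 3) (.div (.mul (.get 3 (var 5) (var 4)) (.get 3 (var 4) (var 6)))
      (.get 3 (var 4) (var 4))))

/-- A bound for the running time of `elimProg`. -/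
def elimTime (d : ℕ) : ℕ := d * (fillTime d + fillTime d + 2) + 2

/-- A step reads the pivot row and column while entries are overwritten in place; the copy in the
real array `3` keeps the old values available. -/
theorem runs_elimProg {d n : ℕ} {v : Fin n → Fin d → ℝ} {s : Store} (h : HasInput v s) :
    Runs elimProg s (elimTime d) fun s' => HasInput v s' ∧ s'.nat 1 = s.nat 1 ∧
      s'.nat 2 = s.nat 2 ∧ s'.nat 3 = s.nat 3 ∧ s'.block d 1 = s.block d 1 ∧
      s'.block d 2 = elim (s.block d 2) d := by
  refine Runs.forLoop (N := d) (fun k s' => (HasInput v s' ∧ s'.nat 1 = s.nat 1 ∧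
      s'.nat 2 = s.nat 2 ∧ s'.nat 3 = s.nat 3 ∧ s'.block d 1 = s.block d 1 ∧
      s'.block d 2 = elim (s.block d 2) k) ∧ s'.nat 4 0 = k) ?_ ?_ (fun _ _ h => h.2) ?_
      fun _ h => h.1
  · refine ⟨⟨h.writeNat (by norm_num), ?_, ?_, ?_, rfl, rfl⟩, ?_⟩ <;> simp [Store.writeNat]
  · rintro j s' ⟨⟨hin, -⟩, -⟩
    exact hin.dim
  · rintro k hk s₁ ⟨⟨hin, h1, h2, h3, hS, hN⟩, h4⟩
    set l : Fin (d + 1) := Fin.ofNat (d + 1) k with hl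
    have hlk : (l : ℕ) = k := by simp [hl, Nat.mod_eq_of_lt (show k < d + 1 by omega)]
    refine .seq ((runs_fill_block hin.dim (s₁.block d 2) fun s' a b hag h5 h6 _ => ?_).mono le_rfl
      ?_)
    · simp only [RExpr.eval, entry, var, NExpr.eval, h5, h6, hag.2 2 (by norm_num), Store.block]
    · rintro s₂ ⟨hag₂, hC⟩
      refine (runs_fill_block (hin.of_agreeOff (by norm_num) hag₂).dim
        (elimStep (s₁.block d 2) l) fun s' a b hag h5 h6 _ => ?_).mono le_rfl ?_
      · have hC' : ∀ a b : Fin (d + 1), s'.real 3 a b = s₁.block d 2 a b := fun a b => by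
          rw [hag.2 3 (by norm_num), ← hC]; rfl
        simp only [RExpr.eval, entry, var, NExpr.eval, h5, h6,
          hag.1 4 (by norm_num) (by norm_num), hag₂.1 4 (by norm_num) (by norm_num), h4, ← hlk,
          hC', elimStep]
      · rintro s₃ ⟨hag₃, hE⟩
        have hn : ∀ c, c ≠ 5 → c ≠ 6 → s₃.nat c = s₁.nat c := fun c h5 h6 =>
          (hag₃.1 c h5 h6).trans (hag₂.1 c h5 h6)
        refine ⟨⟨((hin.of_agreeOff (by norm_num) hag₂).of_agreeOff (by norm_num) hag₃).writeNat
          (by norm_num), ?_, ?_, ?_, ?_, ?_⟩, ?_⟩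
        · simp [Store.writeNat, hn 1, h1]
        · simp [Store.writeNat, hn 2, h2]
        · simp [Store.writeNat, hn 3, h3]
        · rw [← hS, Store.block_writeNat]
          exact Store.block_congr ((hag₃.2 1 (by norm_num)).trans (hag₂.2 1 (by norm_num)))
        · refine Eq.trans ?_ (hE.trans ?_)
          · rfl
          · rw [hN, elim]
        · simp [Store.writeNat, hn 4, h4]

/-- The indicator of the last index, for the index in the variable `x`. -/
def lastIndicator (x : ℕ) : RExpr := .ofNat (.sub (.add (var x) (.lit 1)) (var 0))

/-- Decide whether `vᵢ` is kept, where `i` is the variable `3`; if so, mark it and add `vᵢ vᵢᵀ` to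
the real array `1`, else unmark it. -/
def keepProg : Prog :=
  .seq (fill 2 (.add (.add (.add (entry 1) (.mul (.get 0 (var 3) (var 5)) (lastIndicator 6)))
    (.mul (lastIndicator 5) (.get 0 (var 3) (var 6)))) (.mul (lastIndicator 5) (lastIndicator 6))))
  <| .seq elimProg <|
  .ite (.realLE (.ofNat (.lit 0)) (.get 2 (var 0) (var 0))) (.setNat 1 (var 3) (.lit 0))
    (.seq (.setNat 1 (var 3) (.lit 1)) addOuter)

/-- A bound for the running time of `keepProg`. -/
def keepTime (d : ℕ) : ℕ := fillTime d + (elimTime d + (1 + fillTime d + 1))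

/-- For an index `a ≤ d` the truncated difference `a + 1 - d` is 1 at `a = d` and 0 below. -/
theorem eval_lastIndicator {d : ℕ} {s : Store} (hd : s.nat 0 0 = d) {x : ℕ} {a : Fin (d + 1)}
    (hx : s.nat x 0 = a) :
    (lastIndicator x).eval s = (Pi.single (Fin.last d) 1 : Fin (d + 1) → ℝ) a := by
  simp only [lastIndicator, RExpr.eval, NExpr.eval, var, hd, hx]
  by_cases ha : a = Fin.last d
  · subst ha
    simp
  · rw [Pi.single_eq_of_ne ha]
    have h : (a : ℕ) ≠ d := fun e => ha (Fin.ext e)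
    have : (a : ℕ) + 1 - d = 0 := by omega
    rw [this, Nat.cast_zero]

theorem runs_keepProg {d n : ℕ} {v : Fin n → Fin d → ℝ} {s : Store} (h : HasInput v s)
    {i : Fin n} (hi : s.nat 3 0 = i) :
    Runs keepProg s (keepTime d) fun s' => HasInput v s' ∧ s'.nat 2 = s.nat 2 ∧
      s'.nat 3 = s.nat 3 ∧ (∀ k, k ≠ (i : ℕ) → s'.nat 1 k = s.nat 1 k) ∧
      (s'.nat 1 i = 0 ↔
        0 ≤ elim (bordered (s.block d 1) (v i)) d (Fin.last d) (Fin.last d)) ∧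
      s'.block d 1 = s.block d 1 +
        if s'.nat 1 i = 0 then 0 else vecMulVec (extend (v i)) (extend (v i)) := by
  refine .seq ((runs_fill_block h.dim (bordered (s.block d 1) (v i))
    fun s' a b hag h5 h6 _ => ?_).mono le_rfl ?_)
  · have hin := h.of_agreeOff two_ne_zero hag
    have h1 : s'.real 1 a b = s.block d 1 a b := by rw [hag.2 1 (by norm_num)]; rfl
    simp only [RExpr.eval, entry, eval_lastIndicator hin.dim h5, eval_lastIndicator hin.dim h6]
    simp only [var, NExpr.eval, h5, h6, hag.1 3 (by norm_num) (by norm_num), hi, hin.real_eq, h1,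
      bordered, Matrix.add_apply, vecMulVec_apply, Matrix.single_apply]
    congr 1
    simp only [Pi.single_apply, eq_comm (a := Fin.last d)]
    split_ifs <;> simp_all
  · rintro s₁ ⟨hag₁, hN₁⟩
    have hin₁ := h.of_agreeOff two_ne_zero hag₁
    refine .seq ((runs_elimProg hin₁).mono le_rfl ?_)
    rintro s₂ ⟨hin, h1, h2, h3, hS, hE⟩
    rw [hN₁] at hE
    have h1' : s₂.nat 1 = s.nat 1 := h1.trans (hag₁.1 1 (by norm_num) (by norm_num))
    have h2' : s₂.nat 2 = s.nat 2 := h2.trans (hag₁.1 2 (by norm_num) (by norm_num))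
    have h3' : s₂.nat 3 = s.nat 3 := h3.trans (hag₁.1 3 (by norm_num) (by norm_num))
    have hi₂ : s₂.nat 3 0 = i := by rw [h3', hi]
    have hS' : s₂.block d 1 = s.block d 1 := by
      rw [hS]; exact Store.block_congr (hag₁.2 1 (by norm_num))
    have htest : (Test.realLE (.ofNat (.lit 0)) (.get 2 (var 0) (var 0))).Holds s₂ ↔
        0 ≤ elim (bordered (s.block d 1) (v i)) d (Fin.last d) (Fin.last d) := by
      simp only [Test.Holds, RExpr.eval, NExpr.eval, var, hin.dim, Nat.cast_zero, ← hE,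
        Store.block, Fin.val_last]
    refine .ite (fun hb => ?_) fun hb => ?_
    · refine (Runs.setNat ?_).mono (by omega) fun _ h => h
      simp only [NExpr.eval, var, hi₂]
      refine ⟨hin.writeNat (by norm_num), ?_, ?_, fun k hk => ?_, ?_, ?_⟩
      · simp [Store.writeNat, h2']
      · simp [Store.writeNat, h3']
      · simp [Store.writeNat, hk, h1']
      · simpa [Store.writeNat] using htest.1 hb
      · rw [Store.block_writeNat, if_pos (by simp [Store.writeNat]), hS', add_zero]
    · refine .seq (.setNat ?_)
      simp only [NExpr.eval, var, hi₂]
      refine (runs_addOuter (hin.writeNat (by norm_num)) (i := i) (by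
        simpa [Store.writeNat] using hi₂)).mono le_rfl ?_
      rintro s₃ ⟨hag, hS₃⟩
      have e1 : s₃.nat 1 i = 1 := by simp [hag.1 1, Store.writeNat]
      refine ⟨(hin.writeNat (by norm_num)).of_agreeOff one_ne_zero hag, ?_, ?_, fun k hk => ?_,
        ?_, ?_⟩
      · simp [Store.writeNat, hag.1 2, h2']
      · simp [Store.writeNat, hag.1 3, h3']
      · simp [Store.writeNat, hag.1 1, hk, h1']
      · rw [e1, ← htest]
        simp [hb]
      · rw [e1, if_neg one_ne_zero, hS₃, ← hS']
        rfl

/-- One refinement of the set of the marked vectors. -/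
def refineProg : Prog := .seq gramProg (forLoop 3 countExpr keepProg)

/-- A bound for the running time of `refineProg`. -/
def refineTime (d n : ℕ) : ℕ := gramTime d n + (n * (keepTime d + 2) + 2)

/-- The old marks may be overwritten during the pass, since the scaled Gram form of `W` has been
stored before. After `j` rounds only the marks below `j` are new, so the invariant mentions no
others. -/
theorem runs_refineProg {d n : ℕ} {v : Fin n → Fin d → ℝ} {s : Store} (h : HasInput v s)
    (hcov : Covers v (s.marked n)) :
    Runs refineProg s (refineTime d n) fun s' => HasInput v s' ∧ s'.nat 2 = s.nat 2 ∧
      Refines v (s.marked n) (s'.marked n) := by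
  set W := s.marked n with hW
  refine .seq ((runs_gramProg h).mono le_rfl ?_)
  rintro s₁ ⟨hin₁, -, h2₁, hS₁⟩
  refine Runs.forLoop (N := n) (fun j s' => HasInput v s' ∧ s'.nat 2 = s.nat 2 ∧
    s'.nat 3 0 = j ∧
    s'.block d 1 = (2 * (W.card : ℝ))⁻¹ • gramSum v W + gramSum v (below (s'.marked n) j) ∧
    ∀ i : Fin n, (i : ℕ) < j → (i ∉ s'.marked n ↔ ∀ y, (v i ⬝ᵥ y) ^ 2 ≤
      (2 * (W.card : ℝ))⁻¹ * ∑ k ∈ W, (v k ⬝ᵥ y) ^ 2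
        + ∑ k ∈ below (s'.marked n) i, (v k ⬝ᵥ y) ^ 2))
    ?_ ?_ (fun _ _ h => h.2.2.1) ?_ ?_
  · refine ⟨hin₁.writeNat (by norm_num), ?_, ?_, ?_, by simp⟩
    · simp [Store.writeNat, h2₁]
    · simp [Store.writeNat]
    · rw [below_zero, show gramSum v ∅ = 0 from Finset.sum_empty, add_zero]
      exact hS₁
  · rintro j s' ⟨hin, -⟩
    exact hin.count
  · rintro j hj s₂ ⟨hin, h2, h3, hS, href⟩
    set i : Fin n := ⟨j, hj⟩ with hi
    refine (runs_keepProg (i := i) hin h3).mono le_rfl ?_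
    rintro s₃ ⟨hin₃, h2₃, h3₃, h1₃, htest, hS₃⟩
    set s₄ := s₃.writeNat 3 0 (s₃.nat 3 0 + 1) with hs₄
    have hm : s₄.marked n = s₃.marked n := Store.marked_congr (by simp [hs₄, Store.writeNat])
    -- Round `j` changes only the mark of `j`, so the earlier decisions stand.
    have hbelow : ∀ k ≤ j, below (s₃.marked n) k = below (s₂.marked n) k := fun k hk => by
      ext a
      simp only [below, Finset.mem_filter, Store.mem_marked]
      refine and_congr_left fun ha => ?_
      rw [h1₃ a (by simp [hi]; omega)]
    rw [hS, elim_bordered_gramSum_last_nonneg_iff hcov] at htest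
    refine ⟨hin₃.writeNat (by norm_num), ?_, ?_, ?_, ?_⟩
    · simp [hs₄, Store.writeNat, h2₃, h2]
    · simp [hs₄, Store.writeNat, h3₃, h3]
    · have e : s₄.block d 1 = s₃.block d 1 := rfl
      rw [e, hm, hS₃, hS, add_assoc, show j + 1 = (i : ℕ) + 1 from rfl]
      congr 1
      split_ifs with h0
      · rw [below_succ_of_notMem (by rwa [Store.mem_marked, not_not]), add_zero,
          hbelow i le_rfl]
      · rw [below_succ_of_mem (by rwa [Store.mem_marked]),
          gramSum_insert v (notMem_below_self _ i), hbelow i le_rfl]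
    · intro k hk
      rw [hm, hbelow k (by omega)]
      rcases Nat.lt_succ_iff_lt_or_eq.1 hk with hk | hk
      · rw [← href k hk, Store.mem_marked, Store.mem_marked, h1₃ k (by simp [hi]; omega)]
      · have e : k = i := Fin.ext hk
        rw [e, Store.mem_marked, not_not]
        exact htest
  · rintro s' ⟨hin, h2, -, -, href⟩
    exact ⟨hin, h2, fun i => by simpa only [below, Fin.lt_def] using href i i.2⟩

/-- The program: mark all vectors, refine `n` times, and mark the first vector. -/
def spannerProg : Prog :=
  .seq (forLoop 3 countExpr (.setNat 1 (var 3) (.lit 1))) <|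
  .seq (forLoop 2 countExpr refineProg) (.setNat 1 (.lit 0) (.lit 1))

/-- A bound for the running time of `spannerProg`. -/
def spannerTime (d n : ℕ) : ℕ :=
  n * (1 + 2) + 2 + (n * (refineTime d n + 2) + 2 + 1)

theorem runs_spannerProg {d n : ℕ} (hd : 2 ≤ d) (v : Fin n → Fin d → ℝ) :
    Runs spannerProg (inputStore v) (spannerTime d n) fun s => Covers v (s.marked n) ∧
      (0 < n → (s.marked n).Nonempty) ∧ ((s.marked n).card : ℝ) ≤ 30 * (d * Real.log d) + 1 := by
  have hL : 0 ≤ (d : ℝ) * Real.log d := le_trans zero_le_one (one_le_mul_log hd)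
  refine .seq (Runs.forLoop (N := n) (fun j s => HasInput v s ∧ s.nat 3 0 = j ∧
    ∀ i < j, s.nat 1 i = 1) ?_ ?_ (fun _ _ h => h.2.1) ?_ ?_)
  · exact ⟨HasInput.writeNat ⟨rfl, rfl⟩ (by norm_num), by simp [Store.writeNat], by simp⟩
  · rintro j s ⟨hin, -⟩
    exact hin.count
  · rintro j hj s ⟨hin, h3, h1⟩
    refine .setNat ⟨(hin.writeNat one_ne_zero).writeNat (by norm_num), ?_, fun i hi => ?_⟩
    · simp [Store.writeNat, h3]
    · rcases Nat.lt_succ_iff_lt_or_eq.1 hi with hi | rfl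
      · simp [Store.writeNat, NExpr.eval, var, h3, hi.ne, h1 i hi]
      · simp [Store.writeNat, NExpr.eval, var, h3]
  · rintro s₁ ⟨hin₁, -, h1⟩
    have hall : s₁.marked n = Finset.univ := by
      ext i; simp [Store.mem_marked, h1 i i.2]
    have hmark : ∀ (s : Store) (a i x : ℕ), a ≠ 1 → (s.writeNat a i x).marked n = s.marked n :=
      fun s a i x ha => Store.marked_congr (by simp [Store.writeNat, ha.symm])
    -- Each pass reaches the bound or loses a vector, and the bound persists once reached. At `j =
    -- n` the second alternative leaves the empty set.
    refine .seq (Runs.forLoop (N := n) (fun j s => HasInput v s ∧ s.nat 2 0 = j ∧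
      Covers v (s.marked n) ∧ (((s.marked n).card : ℝ) ≤ 30 * (d * Real.log d) ∨
        (s.marked n).card + j ≤ n)) ?_ ?_ (fun _ _ h => h.2.1) ?_ ?_)
    · refine ⟨hin₁.writeNat (by norm_num), by simp [Store.writeNat], ?_, Or.inr ?_⟩
      · rw [hmark _ _ _ _ (by norm_num), hall]
        intro i y
        have h1 : (v i ⬝ᵥ y) ^ 2 ≤ ∑ k, (v k ⬝ᵥ y) ^ 2 :=
          Finset.single_le_sum (f := fun k => (v k ⬝ᵥ y) ^ 2) (fun _ _ => sq_nonneg _)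
            (Finset.mem_univ i)
        nlinarith [sq_nonneg (v i ⬝ᵥ y)]
      · rw [hmark _ _ _ _ (by norm_num), hall]
        simp
    · rintro j s ⟨hin, -⟩
      exact hin.count
    · rintro j hj s ⟨hin, h2, hcov, hcard⟩
      refine (runs_refineProg hin hcov).mono le_rfl ?_
      rintro s' ⟨hin', h2', href⟩
      refine ⟨hin'.writeNat (by norm_num), by simp [Store.writeNat, h2', h2], ?_, ?_⟩
      · rw [hmark _ _ _ _ (by norm_num)]
        exact href.covers hcov
      · rw [hmark _ _ _ _ (by norm_num)]
        rcases href.card_le_or_lt hd hcov with h | h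
        · exact Or.inl h
        · rcases hcard with hc | hc
          · left
            have : ((s'.marked n).card : ℝ) ≤ (s.marked n).card := by exact_mod_cast h.le
            linarith
          · right; omega
    · rintro s ⟨-, -, hcov, hcard⟩
      -- The covering set may be empty, for instance when the only input vector is 0, but a
      -- distribution needs a nonempty support. Marking the first vector costs at most 1 in the
      -- size.
      refine .setNat ?_
      change Covers v ((s.writeNat 1 0 1).marked n) ∧
        (0 < n → ((s.writeNat 1 0 1).marked n).Nonempty) ∧
        (((s.writeNat 1 0 1).marked n).card : ℝ) ≤ 30 * (d * Real.log d) + 1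
      have hc : ((s.marked n).card : ℝ) ≤ 30 * (d * Real.log d) := by
        rcases hcard with h | h
        · exact h
        · have : (s.marked n).card = 0 := by omega
          rw [this, Nat.cast_zero]; positivity
      have hmem : ∀ i : Fin n, i ∈ (s.writeNat 1 0 1).marked n ↔ (i : ℕ) = 0 ∨ i ∈ s.marked n := by
        intro i
        simp only [Store.mem_marked, Store.writeNat, Function.update_self]
        by_cases hi : (i : ℕ) = 0
        · simp [hi]
        · simp [hi]
      refine ⟨hcov.mono fun i hi => (hmem i).2 (Or.inr hi),
        fun hn => ⟨⟨0, hn⟩, (hmem _).2 (Or.inl rfl)⟩, ?_⟩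
      have hle : ((s.writeNat 1 0 1).marked n).card ≤ (s.marked n).card + 1 := by
        rcases Nat.eq_zero_or_pos n with rfl | hn
        · exact (Finset.card_le_univ _).trans (by simp)
        · refine (Finset.card_le_card (t := insert ⟨0, hn⟩ (s.marked n)) fun i hi => ?_).trans
            (Finset.card_insert_le _ _)
          rcases (hmem i).1 hi with h0 | h0
          · exact Finset.mem_insert.2 (Or.inl (Fin.ext h0))
          · exact Finset.mem_insert_of_mem h0
      have : (((s.writeNat 1 0 1).marked n).card : ℝ) ≤ (s.marked n).card + 1 := by
        exact_mod_cast hle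
      linarith

/-! ### Polynomial running time and conclusion. -/

theorem spannerTime_le {d n : ℕ} (hd : 2 ≤ d) : spannerTime d n ≤ 60 * (d + n) ^ 60 := by
  set X := d + n with hX
  have hX2 : 2 ≤ X := by omega
  have hF : fillTime d ≤ 11 * X ^ 2 := by
    rw [fillTime]
    have : d ≤ X := by omega
    calc _ ≤ (X + 1) * ((X + 1) * (1 + 2) + 2 + 2) + 2 := by gcongr
      _ ≤ _ := by nlinarith
  have hE : elimTime d ≤ 23 * X ^ 3 := by
    rw [elimTime]
    have h1 : d * (fillTime d + fillTime d + 2) ≤ X * (11 * X ^ 2 + 11 * X ^ 2 + 2) := by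
      gcongr; omega
    nlinarith
  have hK : keepTime d ≤ 35 * X ^ 3 := by
    rw [keepTime]
    nlinarith
  have hG : gramTime d n ≤ 24 * X ^ 3 := by
    rw [gramTime]
    have h1 : n * (1 + fillTime d + 1 + 2) ≤ X * (1 + 11 * X ^ 2 + 1 + 2) := by
      gcongr; omega
    nlinarith
  have hR : refineTime d n ≤ 50 * X ^ 4 := by
    rw [refineTime]
    have h1 : n * (keepTime d + 2) ≤ X * (35 * X ^ 3 + 2) := by
      gcongr; omega
    nlinarith [pow_le_pow_left₀ (by norm_num) hX2 3]
  have hS : spannerTime d n ≤ 60 * X ^ 5 := by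
    rw [spannerTime]
    have h1 : n * (refineTime d n + 2) ≤ X * (50 * X ^ 4 + 2) := by
      gcongr; omega
    have h2 : X ≤ X ^ 5 := Nat.le_self_pow (by norm_num) X
    have h3 : n ≤ X := by omega
    nlinarith
  -- Degree 5 suffices; the exponent is raised to 60 because a single number `r` serves as
  -- coefficient and exponent in the final statement.
  refine hS.trans (Nat.mul_le_mul_left _ (Nat.pow_le_pow_right (by omega) (by norm_num)))

end RealRAM

theorem exists_exec_spannerProg {d n : ℕ} (hd : 2 ≤ d) (v : Fin n ↪ (Fin d → ℝ)) :
    ∃ (s : RealRAM.Store) (t : ℕ),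
      RealRAM.Exec RealRAM.spannerProg (RealRAM.inputStore v) s t ∧
      t ≤ 60 * (d + n) ^ 60 ∧
      IsSpectralSpanner (93 * (d * Real.log d ^ 2)) (Finset.univ.map v)
        (RealRAM.outputSet v s) ∧
      ((RealRAM.outputSet v s).card : ℝ) ≤ 93 * (d * Real.log d) := by
  obtain ⟨s, t, hexec, ht, hcov, hne, hcard⟩ := RealRAM.runs_spannerProg hd v
  have hL := one_le_mul_log hd
  refine ⟨s, t, hexec, ht.trans (RealRAM.spannerTime_le hd), ?_, ?_⟩
  · exact hcov.isSpectralSpanner hne (two_mul_le_mul_log_sq hd (by linarith))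
  · rw [RealRAM.outputSet, Finset.card_map]
    exact hcard.trans (by linarith)

theorem theorem1 :
    -- upper bound, with a constant `C` that depends on nothing
    (∃ C : ℝ, 0 < C ∧
      -- the greedy algorithm with `α = C d log² d`, whatever its choices, stops within `C d log d`
      -- iterations, and its output is an `α`-spectral spanner with at most `C d log d` vectors
      (∀ d : ℕ, 2 ≤ d → ∀ (V : Finset (Fin d → ℝ)) (k : ℕ) (U : Finset (Fin d → ℝ)),
        GreedyRun (C * (d * Real.log d ^ 2)) V k U →
          (k : ℝ) ≤ C * (d * Real.log d) ∧
          (GreedyStops (C * (d * Real.log d ^ 2)) V U →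
            IsSpectralSpanner (C * (d * Real.log d ^ 2)) V U ∧
            (U.card : ℝ) ≤ C * (d * Real.log d))) ∧
      -- such a spanner is found by one program in time polynomial in `d` and `|V| = n`
      (∃ (P : RealRAM.Prog) (r : ℕ), ∀ d : ℕ, 2 ≤ d → ∀ (n : ℕ) (v : Fin n ↪ (Fin d → ℝ)),
        ∃ (s : RealRAM.Store) (t : ℕ),
          RealRAM.Exec P (RealRAM.inputStore v) s t ∧
          t ≤ r * (d + n) ^ r ∧
          IsSpectralSpanner (C * (d * Real.log d ^ 2)) (Finset.univ.map v)
            (RealRAM.outputSet v s) ∧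
          ((RealRAM.outputSet v s).card : ℝ) ≤ C * (d * Real.log d))) ∧
    -- lower bound: a set of size `e^{Ω(d^ε)}` all of which is needed, of `±1` vectors if `ε ≤ 1`
    (∃ c : ℝ, 0 < c ∧ ∀ d : ℕ, 2 ≤ d → ∀ ε : ℝ, 0 < ε →
      ∃ V : Finset (Fin d → ℝ),
        Real.exp (c * (d : ℝ) ^ ε) ≤ (V.card : ℝ) ∧
        (ε ≤ 1 → ∀ v ∈ V, ∀ j, v j = 1 ∨ v j = -1) ∧
        ∀ U : Finset (Fin d → ℝ), IsSpectralSpanner ((d : ℝ) ^ (1 - ε)) V U → U = V) ∧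
    -- up to `e^{d^ε / 8} / 2` independent uniformly random `±1` vectors are such a set with
    -- probability at least `1 / 2`
    (∀ d : ℕ, 2 ≤ d → ∀ ε : ℝ, 0 < ε → ε ≤ 1 →
      ∀ N : ℕ, (N : ℝ) ≤ Real.exp ((d : ℝ) ^ ε / 8) / 2 →
        1 / 2 ≤ (PMF.uniformOfFintype (Fin N → Fin d → Bool)).toMeasure
          {b | Function.Injective (fun i => signVector (b i)) ∧
            ∀ U : Finset (Fin d → ℝ),
              IsSpectralSpanner ((d : ℝ) ^ (1 - ε))
                (Finset.univ.image fun i => signVector (b i)) U →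
              U = Finset.univ.image fun i => signVector (b i)}) := by
  refine ⟨⟨93, by norm_num, fun d hd V k U hrun => ⟨hrun.le_mul_log hd, fun hfin => ⟨?_, ?_⟩⟩,
    RealRAM.spannerProg, 60, fun d hd n v => exists_exec_spannerProg hd v⟩,
    ⟨1 / 50, by norm_num, fun d hd ε hε => exists_large_spanner_eq hd hε⟩,
    fun d hd ε _ hε1 N hN => half_le_measure_spanner_eq hd hε1 hN⟩
  · refine isSpectralSpanner_of_greedyStops ?_ hrun.subset hfin
    have h := two_mul_le_mul_log_sq hd (y := 1) (by linarith [one_le_mul_log hd])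
    linarith
  · exact le_trans (by exact_mod_cast hrun.card_le) (hrun.le_mul_log hd)
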